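/- **Setting.** Let $d\ge 2$ and use $\hat f(\xi)=\int_{\mathbb R^d}e^{-ix\cdot\xi}f(x)\,dx$. Fix: - a smooth radial $\varphi:\mathbb R^d\to[0,1]$ with $\varphi=1$ on $|x|\le\sqrt d$ and $\varphi=0$ on $|x|\ge 2\sqrt d$; for $i\in\mathbb Z^d$ put $\varphi_i(x)=\varphi(x-i)/\sum_{k\in\mathbb Z^d}\varphi(x-k)$ and $P_jh=\mathcal F^{-1}(\varphi_j\hat h)$ for $j\in\mathbb Z^d$; - a smooth $\phi:\mathbb R^d\to[0,1]$ with $\phi=1$ on $|\xi|\le1$ and $\phi=0$ for $|\xi|>2$; for $M\in2^{\mathbb Z}$ put $\phi_M(\xi)=\phi(\xi/M)-\phi(2\xi/M)$ and $P_Mh=\mathcal F^{-1}(\phi_M\hat h)$; - an orthonormal Hilbert basis $(b_{k,l})_{k\ge0,\,1\le l\le N_k}$ of $L^2(S^{d-1})$ with $b_{k,l}\in E_k$, where $E_k$ is the space of restrictions to $S^{d-1}$ of homogeneous harmonic polynomials of degree $k$ and $N_k=\dim E_k$; - independent mean-zero real random variables $X^M_{i,j,k,l}$ ($M\in2^{\mathbb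 Z}$, $i,j\in\mathbb Z^d$, $k\ge 0$, $1\le l\le N_k$) on a probability space $\Omega$ and a constant $c>0$ with $\mathbb E\,e^{\gamma X^M_{i,j,k,l}}\le e^{c\gamma^2}$ for all $\gamma\in\mathbb R$ and all indices. For $f\in L^2(\mathbb R^d)$ let $g^M_i=(P_M(\varphi_if))(M^{-1}\,\cdot)$, expand $\widehat{g^M_i}(\rho\theta)=\sum_{k,l}\hat c^{M,i}_{k,l}(\rho)\,b_{k,l}(\theta)$ ($\rho>0$, $\theta\in S^{d-1}$), let $g^{M,i}_{k,l}$ be the function whose Fourier transform is $\rho\theta\mapsto\hat c^{M,i}_{k,l}(\rho)b_{k,l}(\theta)$, and let $f^{M,i}_{k,l}=g^{M,i}_{k,l}(M\,\cdot)$. The randomisation of $f$ is $$f^\omega=\sum_{M,i,j,k,l}X^M_{i,j,k,l}(\omega)\,P_jf^{M,i}_{k,l},$$ the sum being taken in $L^2(\Omega;L^2(\mathbb R^d))$. Write $\|f\|_{H^s}=\|(1+|\xi|^2)^{s/2}\hat f\|_{L^2_\xi}$ and $\|f\|_{\dot H^s}=\||\xi|^s\hat f\|_{L^2_\xi}$.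 **Proposition A.1.** For every $S>0$ there is a constant $C>0$, depending only on $d$, $S$, the bump $\varphi$ and the constant $c$, such that for all $0<s\le S$ and all $f\in H^s(\mathbb R^d)$ the series defining $f^\omega$ converges unconditionally in $L^2(\Omega;L^2(\mathbb R^d))$, and $$\big\|\,\|f^\omega\|_{\dot H^s_x}\big\|_{L^q_\omega(\Omega)}\le C\sqrt q\,\|f\|_{H^s(\mathbb R^d)}\qquad\text{for all real } q\ge2 .$$ Hence $f^\omega\in H^s(\mathbb R^d)$ for almost every $\omega$. -/

import Mathlib

open MeasureTheory ProbabilityTheory Filter Topology FourierTransform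
open scoped ENNReal NNReal ComplexConjugate

noncomputable section

namespace Rand

/-- Euclidean space `ℝ^d`. -/
abbrev E (d : ℕ) : Type := EuclideanSpace ℝ (Fin d)

/-- The Hilbert space `L²(ℝ^d; ℂ)`. -/
abbrev L2 (d : ℕ) : Type := Lp ℂ 2 (volume : Measure (E d))

/-- The unit sphere `S^{d-1}`. -/
abbrev Sph (d : ℕ) : Type := Metric.sphere (0 : E d) 1

/-- Surface measure on the unit sphere. -/
abbrev surf (d : ℕ) : Measure (Sph d) := (volume : Measure (E d)).toSphere

variable {d : ℕ}

open Classical in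
/-- The class in `L²(ℝ^d)` of a square-integrable function. (The value `0` for other functions is
never used: the lemmas at the end show that all functions it is applied to in the construction are
square-integrable.) -/
def toL2 (u : E d → ℂ) : L2 d :=
  if h : MemLp u 2 (volume : Measure (E d)) then h.toLp u else 0

/-! ### Fourier transform with the convention `f̂(ξ) = ∫ e^{-i x·ξ} f(x) dx` -/

/-- `f̂(ξ) = ∫ e^{-i x·ξ} f(x) dx`, extended to `L²`; Mathlib's transform has the kernel
`e^{-2πi x·η}`. -/
def hat (f : L2 d) : E d → ℂ := fun ξ => (𝓕 f : L2 d) ((2 * Real.pi)⁻¹ • ξ)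

/-- The inverse of `hat`, i.e. `(2π)^{-d} ∫ e^{i x·ξ} h(ξ) dξ`, for square-integrable `h`. -/
def invHat (h : E d → ℂ) : L2 d := 𝓕⁻ (toL2 fun η => h ((2 * Real.pi) • η))

/-- The Fourier multiplier with symbol `m(ξ)`. -/
def fourierMult (m : E d → ℝ) (f : L2 d) : L2 d := invHat fun ξ => (m ξ : ℂ) * hat f ξ

/-- Pointwise multiplication by a function. -/
def mulL2 (m : E d → ℝ) (f : L2 d) : L2 d := toL2 fun x => (m x : ℂ) * f x

/-- The dilation `f(a ·)`. -/
def dilate (a : ℝ) (f : L2 d) : L2 d := toL2 fun x => f (a • x)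

/-! ### Sobolev norms -/

/-- `‖f‖_{H^s} = ‖(1 + |ξ|²)^{s/2} f̂‖_{L²}`, with value `∞` when `f ∉ H^s`. -/
def sobolevNorm (s : ℝ) (f : L2 d) : ℝ≥0∞ :=
  eLpNorm (fun ξ : E d => ((1 + ‖ξ‖ ^ 2) ^ (s / 2) : ℝ) • hat f ξ) 2 volume

/-- `‖f‖_{Ḣ^s} = ‖|ξ|^s f̂‖_{L²}`. -/
def homSobolevNorm (s : ℝ) (f : L2 d) : ℝ≥0∞ :=
  eLpNorm (fun ξ : E d => (‖ξ‖ ^ s : ℝ) • hat f ξ) 2 volume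

/-- `f ∈ H^s(ℝ^d)`, for `f ∈ L²(ℝ^d)` (so `s ≥ 0`). -/
def MemH (s : ℝ) (f : L2 d) : Prop := sobolevNorm s f < ∞

/-! ### Unit-scale decomposition -/

/-- The admissible bumps for the unit-scale partitions in physical and in frequency space. -/
structure IsUnitBump (φ : E d → ℝ) : Prop where
  smooth : ContDiff ℝ (⊤ : ℕ∞) φ
  radial : ∀ x y, ‖x‖ = ‖y‖ → φ x = φ y
  nonneg : ∀ x, 0 ≤ φ x
  le_one : ∀ x, φ x ≤ 1
  eq_one : ∀ x, ‖x‖ ≤ √(d : ℝ) → φ x = 1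
  eq_zero : ∀ x, 2 * √(d : ℝ) ≤ ‖x‖ → φ x = 0

/-- The point of `ℝ^d` with the integer coordinates `i`. -/
def latticePt (i : Fin d → ℤ) : E d := WithLp.toLp 2 fun n => (i n : ℝ)

/-- `φ_i(x) = φ(x - i) / ∑_{k ∈ ℤ^d} φ(x - k)`. -/
def unitCut (φ : E d → ℝ) (i : Fin d → ℤ) (x : E d) : ℝ :=
  φ (x - latticePt i) / ∑' k : Fin d → ℤ, φ (x - latticePt k)

/-! ### Dyadic decomposition -/

/-- The admissible bumps for the dyadic decomposition in frequency. -/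
structure IsDyadicBump (χ : E d → ℝ) : Prop where
  smooth : ContDiff ℝ (⊤ : ℕ∞) χ
  nonneg : ∀ x, 0 ≤ χ x
  le_one : ∀ x, χ x ≤ 1
  eq_one : ∀ x, ‖x‖ ≤ 1 → χ x = 1
  eq_zero : ∀ x, 2 < ‖x‖ → χ x = 0

/-- `χ_M(ξ) = χ(ξ / M) - χ(2 ξ / M)` for `M = 2^m`. -/
def dyadicCut (χ : E d → ℝ) (m : ℤ) (ξ : E d) : ℝ :=
  χ (((2 : ℝ) ^ m)⁻¹ • ξ) - χ ((2 / (2 : ℝ) ^ m) • ξ)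

/-! ### Spherical harmonics -/

/-- The space `E_k` of surface spherical harmonics of degree `k`: the restrictions to the sphere of
homogeneous harmonic polynomials of degree `k`. -/
def sphHarm (d k : ℕ) : Submodule ℂ (Sph d → ℂ) where
  carrier := {Y | ∃ p : MvPolynomial (Fin d) ℂ, p.IsHomogeneous k ∧
    (∑ n, MvPolynomial.pderiv n (MvPolynomial.pderiv n p)) = 0 ∧
    ∀ θ : Sph d, Y θ = MvPolynomial.eval (fun n => (((θ : E d) n : ℝ) : ℂ)) p}
  zero_mem' := ⟨0, MvPolynomial.isHomogeneous_zero _ _ _, by simp, by simp⟩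
  add_mem' := by
    rintro Y Z ⟨p, hp, hp', hpY⟩ ⟨r, hr, hr', hrZ⟩
    exact ⟨p + r, hp.add hr, by simp [Finset.sum_add_distrib, hp', hr'], by simp [hpY, hrZ]⟩
  smul_mem' := by
    rintro c Y ⟨p, hp, hp', hpY⟩
    refine ⟨MvPolynomial.C c * p, by simpa using (MvPolynomial.isHomogeneous_C _ c).mul hp, ?_,
      by simp [hpY]⟩
    simp [← Finset.mul_sum, hp']

/-- `N_k = dim E_k`. -/
def numHarm (d k : ℕ) : ℕ := Module.finrank ℂ (sphHarm d k)

/-- `(b_{k,l})`, `k ≥ 0`, `1 ≤ l ≤ N_k`, is an orthonormal Hilbert basis of `L²(S^{d-1})` with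
`b_{k,l} ∈ E_k`. -/
structure IsHarmBasis (b : (k : ℕ) → Fin (numHarm d k) → Sph d → ℂ) : Prop where
  mem : ∀ k l, b k l ∈ sphHarm d k
  norm_one : ∀ k l, ∫ θ, b k l θ * conj (b k l θ) ∂(surf d) = 1
  orthogonal : ∀ k l k' l', (⟨k, l⟩ : Σ k, Fin (numHarm d k)) ≠ ⟨k', l'⟩ →
    ∫ θ, b k l θ * conj (b k' l' θ) ∂(surf d) = 0
  total : ∀ u : Sph d → ℂ, MemLp u 2 (surf d) →
    (∀ k l, ∫ θ, u θ * conj (b k l θ) ∂(surf d) = 0) → u =ᵐ[surf d] 0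

/-- The coefficient `ρ ↦ ∫_{S^{d-1}} u(ρθ) conj(Y(θ)) dσ(θ)` of `u` along `Y`. -/
def angCoeff (u : E d → ℂ) (Y : Sph d → ℂ) (ρ : ℝ) : ℂ :=
  ∫ θ : Sph d, u (ρ • (θ : E d)) * conj (Y θ) ∂(surf d)

open Classical in
/-- The function `ρθ ↦ c(ρ) Y(θ)` (with the value `0` at the origin). -/
def polarFun (c : ℝ → ℂ) (Y : Sph d → ℂ) (ξ : E d) : ℂ :=
  if h : ξ = 0 then 0
  else c ‖ξ‖ * Y ⟨‖ξ‖⁻¹ • ξ, by simp [norm_smul, h]⟩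

/-! ### The pieces of the decomposition and the randomisation -/

/-- `P_M h = F⁻¹(χ_M ĥ)`, `M = 2^m`. -/
def dyadicProj (χ : E d → ℝ) (m : ℤ) (h : L2 d) : L2 d := fourierMult (dyadicCut χ m) h

/-- `P_j h = F⁻¹(φ_j ĥ)`. -/
def unitProj (φ : E d → ℝ) (j : Fin d → ℤ) (h : L2 d) : L2 d := fourierMult (unitCut φ j) h

/-- `g_i^M = (P_M (φ_i f))(M⁻¹ ·)`, `M = 2^m`. -/
def rescaledPiece (φ χ : E d → ℝ) (f : L2 d) (m : ℤ) (i : Fin d → ℤ) : L2 d :=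
  dilate ((2 : ℝ) ^ m)⁻¹ (dyadicProj χ m (mulL2 (unitCut φ i) f))

/-- The angular component along `Y` of `g`, taken on the Fourier side: the function whose Fourier
transform is `ρθ ↦ ĉ(ρ) Y(θ)`, where `ĉ` is the coefficient of `ĝ` along `Y`. -/
def angPiece (Y : Sph d → ℂ) (g : L2 d) : L2 d := invHat (polarFun (angCoeff (hat g) Y) Y)

/-- `f_{k,l}^{M,i}` for `Y = b_{k,l}`, `M = 2^m`: the angular component along `Y` of `g_i^M`,
scaled back to frequency `M`. -/
def angularPiece (φ χ : E d → ℝ) (Y : Sph d → ℂ) (f : L2 d) (m : ℤ) (i : Fin d → ℤ) : L2 d :=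
  dilate ((2 : ℝ) ^ m) (angPiece Y (rescaledPiece φ χ f m i))

/-- The indices `(M, i, j, k, l)` with `M = 2^m`. -/
structure Idx (d : ℕ) where
  m : ℤ
  i : Fin d → ℤ
  j : Fin d → ℤ
  k : ℕ
  l : Fin (numHarm d k)

/-- The term `P_j f_{k,l}^{M,i}`. -/
def piece (φ χ : E d → ℝ) (b : (k : ℕ) → Fin (numHarm d k) → Sph d → ℂ) (f : L2 d)
    (n : Idx d) : L2 d :=
  unitProj φ n.j (angularPiece φ χ (b n.k n.l) f n.m n.i)

/-- The standing assumptions on the random coefficients: independent, mean-zero, real random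
variables with `E[e^{γX}] ≤ e^{cγ²}` for all real `γ`. -/
structure IsRandomFamily {Ω ι : Type*} [MeasurableSpace Ω] (P : Measure Ω) (c : ℝ)
    (X : ι → Ω → ℝ) : Prop where
  measurable : ∀ n, Measurable (X n)
  indep : iIndepFun X P
  integrable : ∀ n, Integrable (X n) P
  mean_zero : ∀ n, ∫ ω, X n ω ∂P = 0
  integrable_exp : ∀ n (γ : ℝ), Integrable (fun ω => Real.exp (γ * X n ω)) P
  exp_bound : ∀ n (γ : ℝ), ∫ ω, Real.exp (γ * X n ω) ∂P ≤ Real.exp (c * γ ^ 2)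

/-- `F` is the sum `∑_n X_n(ω) a_n`, the series converging unconditionally in `L²(Ω; L²(ℝ^d))`. -/
structure IsRandomSum {Ω ι : Type*} [MeasurableSpace Ω] (P : Measure Ω)
    (X : ι → Ω → ℝ) (a : ι → L2 d) (F : Ω → L2 d) : Prop where
  memLp : MemLp F 2 P
  tendsto : Tendsto (fun t : Finset ι => eLpNorm (fun ω => (∑ n ∈ t, X n ω • a n) - F ω) 2 P)
    atTop (𝓝 0)

/-- `F = f^ω` is the randomisation of `f`: `f^ω = ∑_{M,i,j,k,l} X^M_{i,j,k,l}(ω) P_j f_{k,l}^{M,i}`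
in `L²(Ω; L²(ℝ^d))`. -/
def IsRandomisation {Ω : Type*} [MeasurableSpace Ω] (P : Measure Ω) (φ χ : E d → ℝ)
    (b : (k : ℕ) → Fin (numHarm d k) → Sph d → ℂ) (X : Idx d → Ω → ℝ) (f : L2 d)
    (F : Ω → L2 d) : Prop :=
  IsRandomSum P X (piece φ χ b f) F

/-! ### Square-integrability of the functions to which `toL2` is applied -/

theorem memLp_mul_of_bound {m : E d → ℝ} (hm : Measurable m) {B : ℝ} (hB : ∀ x, |m x| ≤ B)
    {u : E d → ℂ} (hu : MemLp u 2 volume) : MemLp (fun x => (m x : ℂ) * u x) 2 volume := by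
  refine MemLp.of_le_mul (c := B) hu
    ((Complex.measurable_ofReal.comp hm).aestronglyMeasurable.mul hu.1) (.of_forall fun x => ?_)
  rw [norm_mul, Complex.norm_real, Real.norm_eq_abs]
  exact mul_le_mul_of_nonneg_right (hB x) (norm_nonneg _)

theorem memLp_comp_smul {a : ℝ} (ha : a ≠ 0) {u : E d → ℂ} (hu : MemLp u 2 volume) :
    MemLp (fun x => u (a • x)) 2 (volume : Measure (E d)) := by
  have he : MeasurableEmbedding (fun x : E d => a • x) :=
    (Homeomorph.smulOfNeZero a ha).measurableEmbedding
  have := (he.memLp_map_measure_iff (g := u) (p := 2) (μ := (volume : Measure (E d)))).1 (by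
    rw [Measure.map_addHaar_smul volume ha]
    exact hu.smul_measure ENNReal.ofReal_ne_top)
  exact this

theorem memLp_dilate {a : ℝ} (ha : a ≠ 0) (f : L2 d) :
    MemLp (fun x => f (a • x)) 2 (volume : Measure (E d)) := memLp_comp_smul ha (Lp.memLp f)

theorem memLp_hat (f : L2 d) : MemLp (hat f) 2 (volume : Measure (E d)) :=
  memLp_comp_smul (by positivity) (Lp.memLp (𝓕 f : L2 d))

theorem continuous_of_mem_sphHarm {k : ℕ} {Y : Sph d → ℂ} (hY : Y ∈ sphHarm d k) :
    Continuous Y := by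
  obtain ⟨p, -, -, h⟩ := hY
  rw [funext h]
  refine (MvPolynomial.continuous_eval p).comp ?_
  fun_prop

theorem memLp_angPiece {Y : Sph d → ℂ} (hY : Continuous Y) (g : L2 d) :
    MemLp (polarFun (angCoeff (hat g) Y) Y) 2 (volume : Measure (E d)) := by
  rcases Nat.eq_zero_or_pos d with rfl | hd
  · have : polarFun (angCoeff (hat g) Y) Y = 0 := by
      funext ξ
      simp [polarFun, Subsingleton.elim ξ 0]
    rw [this]; exact MemLp.zero
  have : Nontrivial (E d) := by
    have : Nonempty (Fin d) := ⟨⟨0, hd⟩⟩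
    infer_instance
  obtain ⟨B, hB⟩ : ∃ B : ℝ, ∀ θ, ‖Y θ‖ ≤ B := by
    obtain ⟨B, hB⟩ := isCompact_univ.exists_bound_of_continuousOn hY.continuousOn
    exact ⟨B, fun θ => hB θ trivial⟩
  set u := hat g with hu
  have hum : StronglyMeasurable u :=
    (Lp.stronglyMeasurable _).comp_measurable (measurable_const_smul _)
  set Φ := homeomorphUnitSphereProd (E d)
  set ν := Measure.volumeIoiPow (Module.finrank ℝ (E d) - 1)
  have hΦ := (volume : Measure (E d)).measurePreserving_homeomorphUnitSphereProd
  -- measurability of the coefficient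
  have hw : StronglyMeasurable (fun z : Set.Ioi (0 : ℝ) × Sph d =>
      u ((z.1 : ℝ) • (z.2 : E d)) * conj (Y z.2)) := by
    refine (hum.comp_measurable (by fun_prop)).mul ?_
    exact (Complex.continuous_conj.comp (hY.comp continuous_snd)).stronglyMeasurable
  have hc : StronglyMeasurable (fun ρ : Set.Ioi (0 : ℝ) => angCoeff u Y ρ) :=
    hw.integral_prod_right
  have hG : StronglyMeasurable (fun z : Sph d × Set.Ioi (0 : ℝ) => angCoeff u Y z.2 * Y z.1) :=
    (hc.comp_measurable measurable_snd).mul (hY.comp continuous_fst).stronglyMeasurable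
  have hu2 : MemLp (fun z : Sph d × Set.Ioi (0 : ℝ) => u ((z.2 : ℝ) • (z.1 : E d))) 2
      ((surf d).prod ν) := by
    have h1 : MemLp (fun z : ({0}ᶜ : Set (E d)) => u z) 2
        (Measure.comap (↑) (volume : Measure (E d))) := by
      refine ((MeasurableEmbedding.subtype_coe
        (measurableSet_singleton (0 : E d)).compl).memLp_map_measure_iff (g := u)).1 ?_
      rw [map_comap_subtype_coe (measurableSet_singleton (0 : E d)).compl]
      exact (memLp_hat g).restrict _
    exact h1.comp_measurePreserving (hΦ.symm Φ.toMeasurableEquiv)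
  have hbd : ∀ ρ : ℝ, ‖angCoeff u Y ρ‖ₑ ^ (2 : ℝ) ≤
      ENNReal.ofReal B ^ (2 : ℝ) * (surf d Set.univ *
        ∫⁻ θ : Sph d, ‖u (ρ • (θ : E d))‖ₑ ^ (2 : ℝ) ∂(surf d)) := by
    intro ρ
    have hum' : AEMeasurable (fun θ : Sph d => ‖u (ρ • (θ : E d))‖ₑ) (surf d) :=
      (hum.comp_measurable
        (by fun_prop : Measurable fun θ : Sph d => ρ • (θ : E d))).enorm.aemeasurable
    have e1 : ‖angCoeff u Y ρ‖ₑ ≤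
        ENNReal.ofReal B * ∫⁻ θ : Sph d, ‖u (ρ • (θ : E d))‖ₑ ∂(surf d) := by
      refine (enorm_integral_le_lintegral_enorm _).trans ?_
      rw [← lintegral_const_mul'' _ hum']
      refine lintegral_mono fun θ => ?_
      rw [enorm_mul, mul_comm]
      gcongr
      rw [← ofReal_norm]
      exact ENNReal.ofReal_le_ofReal (by simpa using hB θ)
    have e2 : (∫⁻ θ : Sph d, ‖u (ρ • (θ : E d))‖ₑ ∂(surf d)) ^ (2 : ℝ) ≤
        surf d Set.univ * ∫⁻ θ : Sph d, ‖u (ρ • (θ : E d))‖ₑ ^ (2 : ℝ) ∂(surf d) := by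
      have := ENNReal.lintegral_mul_le_Lp_mul_Lq (surf d) Real.HolderConjugate.two_two
        (f := fun _ => 1) (g := fun θ : Sph d => ‖u (ρ • (θ : E d))‖ₑ) (by fun_prop) hum'
      simp only [Pi.mul_apply, one_mul, ENNReal.one_rpow, lintegral_const] at this
      refine (ENNReal.rpow_le_rpow this (by norm_num : (0 : ℝ) ≤ 2)).trans ?_
      rw [ENNReal.mul_rpow_of_nonneg _ _ (by norm_num), ← ENNReal.rpow_mul, ← ENNReal.rpow_mul]
      norm_num
    refine (ENNReal.rpow_le_rpow e1 (by norm_num : (0 : ℝ) ≤ 2)).trans ?_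
    rw [ENNReal.mul_rpow_of_nonneg _ _ (by norm_num)]
    gcongr
  have hG2 : MemLp (fun z : Sph d × Set.Ioi (0 : ℝ) => angCoeff u Y z.2 * Y z.1) 2
      ((surf d).prod ν) := by
    refine MemLp.of_le_mul (c := B) (g := fun z : Sph d × Set.Ioi (0 : ℝ) => angCoeff u Y z.2)
      ⟨(hc.comp_measurable measurable_snd).aestronglyMeasurable, ?_⟩ hG.aestronglyMeasurable
      (.of_forall fun z => by
        rw [norm_mul, mul_comm]
        exact mul_le_mul_of_nonneg_right (hB _) (norm_nonneg _))
    have h2 := hu2.2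
    rw [eLpNorm_lt_top_iff_lintegral_rpow_enorm_lt_top (by norm_num) (by norm_num)] at h2 ⊢
    simp only [ENNReal.toReal_ofNat] at h2 ⊢
    rw [lintegral_prod_symm _ (by
      exact ((hum.comp_measurable (by fun_prop)).enorm.pow_const _).aemeasurable)] at h2
    rw [lintegral_prod_symm _ (by
      exact (((hc.comp_measurable measurable_snd).enorm).pow_const _).aemeasurable)]
    simp only [lintegral_const]
    calc _ ≤ ∫⁻ ρ : Set.Ioi (0 : ℝ), (ENNReal.ofReal B ^ (2 : ℝ) * surf d Set.univ *
          surf d Set.univ) * ∫⁻ θ : Sph d, ‖u ((ρ : ℝ) • (θ : E d))‖ₑ ^ (2 : ℝ) ∂(surf d) ∂ν := by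
          refine lintegral_mono fun ρ => ?_
          refine (mul_le_mul_left (hbd ρ) _).trans (le_of_eq ?_)
          ring
      _ < ⊤ := by
          rw [lintegral_const_mul' _ _ (by finiteness)]
          exact ENNReal.mul_lt_top (by finiteness) h2
  have h3 : MemLp (fun z : ({0}ᶜ : Set (E d)) => polarFun (angCoeff u Y) Y z) 2
      (Measure.comap (↑) (volume : Measure (E d))) := by
    have h4 := hG2.comp_measurePreserving hΦ
    refine (memLp_congr_ae (.of_forall fun z => ?_)).1 h4
    have hz : (z : E d) ≠ 0 := z.2
    simp only [Function.comp_apply, polarFun, dif_neg hz, homeomorphUnitSphereProd_apply_snd_coe]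
    congr 2
    exact Subtype.ext (by simp)
  have h5 := ((MeasurableEmbedding.subtype_coe
    (measurableSet_singleton (0 : E d)).compl).memLp_map_measure_iff
      (g := polarFun (angCoeff u Y) Y)).2 h3
  rwa [map_comap_subtype_coe (measurableSet_singleton (0 : E d)).compl,
    MeasureTheory.restrict_compl_singleton] at h5

theorem abs_unitCut_le {φ : E d → ℝ} (hφ : IsUnitBump φ) (i : Fin d → ℤ) (x : E d) :
    |unitCut φ i x| ≤ 1 := by
  unfold unitCut
  rw [abs_of_nonneg (div_nonneg (hφ.nonneg _) (tsum_nonneg fun k => hφ.nonneg _))]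
  by_cases h : Summable fun k : Fin d → ℤ => φ (x - latticePt k)
  · exact div_le_one_of_le₀ (h.le_tsum i fun k _ => hφ.nonneg _) (tsum_nonneg fun k => hφ.nonneg _)
  · simp [tsum_eq_zero_of_not_summable h]

theorem measurable_unitCut {φ : E d → ℝ} (hφ : IsUnitBump φ) (i : Fin d → ℤ) :
    Measurable (unitCut φ i) := by
  have := hφ.smooth.continuous
  unfold unitCut
  refine Measurable.div (by fun_prop) (Measurable.tsum fun k => by fun_prop)

theorem abs_dyadicCut_le {χ : E d → ℝ} (hχ : IsDyadicBump χ) (m : ℤ) (ξ : E d) :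
    |dyadicCut χ m ξ| ≤ 1 := by
  unfold dyadicCut
  rw [abs_le]
  constructor <;> linarith [hχ.nonneg (((2 : ℝ) ^ m)⁻¹ • ξ), hχ.nonneg ((2 / (2 : ℝ) ^ m) • ξ),
    hχ.le_one (((2 : ℝ) ^ m)⁻¹ • ξ), hχ.le_one ((2 / (2 : ℝ) ^ m) • ξ)]

theorem measurable_dyadicCut {χ : E d → ℝ} (hχ : IsDyadicBump χ) (m : ℤ) :
    Measurable (dyadicCut χ m) := by
  have := hχ.smooth.continuous
  unfold dyadicCut
  fun_prop

end Rand

end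

open Rand

open MeasureTheory ProbabilityTheory Filter Topology FourierTransform
open scoped ENNReal NNReal ComplexConjugate

noncomputable section

namespace Rand

variable {d : ℕ}

open scoped SchwartzMap

/-! ### The Fourier transform on `L²` -/

/-! Write `a_n` for the pieces, `n = (M, i, j, k, l)`. At a fixed frequency ξ the transform of the
random sum is a scalar series `∑ X_n â_n(ξ)` in independent sub-Gaussian variables. Khintchine's
inequality (`IsRandomFamily.lintegral_enorm_sum_rpow_le`) bounds its `L^q(Ω)` norm by a multiple of
`√q (∑ |â_n(ξ)|²)^{1/2}`. As `q ≥ 2`, Minkowski's inequality (`lintegral_lintegral_rpow_le`) takes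
`L^q(Ω)` inside the weighted `L²` norm in ξ. What remains is deterministic: the square sum of the
`H^s` norms of the pieces is at most a constant times `‖f‖²_{H^s}`
(`exists_tsum_weightedSq_piece_le`).

The frequency decompositions cost almost nothing, for any radial weight. The squares of the unit
cuts sum to at most one, the spherical harmonics obey Bessel's inequality on each sphere, and at
most three dyadic cuts are nonzero at a given frequency. The dilations around the angular step
cancel.

The sum over the spatial cells `i` is the real issue (`tsum_enorm_fourier_unitCut_sq_le`,
`tsum_weightedSq_unitCut_le`). Multiplication by `φ_i` spreads frequencies. Moving the factor `(1 +
|ζ|²)^N` onto `φ_i` as a differential operator preserves its support, so bounded overlap of the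
supports yields square summability in `i` together with decay in the frequency shift. The weight of
`H^s` tolerates bounded shifts, unlike `|ξ|^{2s}` near the origin; hence the inhomogeneous norm on
the right.

These bounds hold for finite sums. They pass to the limit by lower semicontinuity of the weighted
norm and Fatou's lemma, while the case `s = 0` gives unconditional convergence. -/

theorem integral_fourier_mul_eq (f : L2 d) (g : 𝓢(E d, ℂ)) :
    ∫ x, (𝓕 g) x * f x = ∫ x, g x * (𝓕 f : L2 d) x := by
  have h := congrArg (fun T : 𝓢'(E d, ℂ) => T g) (Lp.fourier_toTemperedDistribution_eq f)
  simpa [TemperedDistribution.fourier_apply] using h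

theorem integral_fourierInv_mul_eq (f : L2 d) (g : 𝓢(E d, ℂ)) :
    ∫ x, (𝓕⁻ g) x * f x = ∫ x, g x * (𝓕⁻ f : L2 d) x := by
  have h := congrArg (fun T : 𝓢'(E d, ℂ) => T g) (Lp.fourierInv_toTemperedDistribution_eq f)
  simpa [TemperedDistribution.fourierInv_apply] using h

/-- A locally integrable function that satisfies the duality relation of the Fourier transform
of `f` is the Fourier transform of `f`. -/
theorem fourier_ae_eq_of_forall (f : L2 d) {v : E d → ℂ} (hv : LocallyIntegrable v)
    (h : ∀ g : 𝓢(E d, ℂ), HasCompactSupport g → ∫ x, (𝓕 g) x * f x = ∫ x, g x * v x) :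
    (𝓕 f : L2 d) =ᵐ[volume] v := by
  refine ae_eq_of_integral_contDiff_smul_eq
    ((Lp.memLp (𝓕 f : L2 d)).locallyIntegrable (by norm_num)) hv fun g hg hgc => ?_
  have hc : HasCompactSupport (Complex.ofRealCLM ∘ g) := hgc.comp_left rfl
  have hs : ContDiff ℝ (⊤ : ℕ∞) (Complex.ofRealCLM ∘ g) := by fun_prop
  have := (integral_fourier_mul_eq f (hc.toSchwartzMap hs)).symm.trans (h _ hc)
  simpa using this

theorem toL2_coeFn {u : E d → ℂ} (hu : MemLp u 2 (volume : Measure (E d))) :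
    toL2 u =ᵐ[volume] u := by
  rw [toL2, dif_pos hu]
  exact hu.coeFn_toLp

theorem continuous_fourier {u : E d → ℂ} (hu : Integrable u) : Continuous (𝓕 u) :=
  VectorFourier.fourierIntegral_continuous Real.continuous_fourierChar
    (by exact continuous_inner) hu

/-- The spatially localised pieces are integrable, so this makes their transforms honest integrals
that can be estimated at each single frequency. -/
theorem fourier_toL2 {u : E d → ℂ} (hu : Integrable u) (hu2 : MemLp u 2 (volume : Measure (E d))) :
    (𝓕 (toL2 u) : L2 d) =ᵐ[volume] 𝓕 u := by
  refine fourier_ae_eq_of_forall _ (continuous_fourier hu).locallyIntegrable fun g _ => ?_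
  have h1 := VectorFourier.integral_fourierIntegral_smul_eq_flip (L := innerₗ (E d))
    (μ := volume) (ν := volume) (f := g) (g := u) Real.continuous_fourierChar
    (by exact continuous_inner) g.integrable hu
  rw [flip_innerₗ] at h1
  refine (integral_congr_ae ?_).trans h1
  filter_upwards [toL2_coeFn hu2] with x hx
  rw [hx]; rfl

theorem fourier_comp_sub (g : E d → ℂ) (a x : E d) :
    𝓕 (fun y => g (y - a)) x = Real.fourierChar (-inner ℝ a x) • 𝓕 g x := by
  rw [Real.fourier_eq, Real.fourier_eq,
    ← integral_add_right_eq_self (fun v => Real.fourierChar (-inner ℝ v x) • g (v - a)) a,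
    Circle.smul_def, ← integral_smul]
  refine integral_congr_ae (.of_forall fun v => ?_)
  simp only [add_sub_cancel_right, inner_add_left, neg_add, AddChar.map_add_eq_mul, Circle.smul_def,
    mul_smul]
  rw [smul_comm]

theorem fourierInv_comp_sub (g : E d → ℂ) (a x : E d) :
    𝓕⁻ (fun y => g (y - a)) x = Real.fourierChar (inner ℝ a x) • 𝓕⁻ g x := by
  rw [Real.fourierInv_eq_fourier_neg, fourier_comp_sub, Real.fourierInv_eq_fourier_neg,
    inner_neg_right, neg_neg]

theorem fourier_comp_smul (g : E d → ℂ) {a : ℝ} (ha : a ≠ 0) (x : E d) :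
    𝓕 (fun y => g (a • y)) x = (|a ^ d|⁻¹ : ℝ) • 𝓕 g (a⁻¹ • x) := by
  have := Measure.integral_comp_smul volume
    (fun v : E d => Real.fourierChar (-inner ℝ v (a⁻¹ • x)) • g v) a
  simp only [finrank_euclideanSpace, Fintype.card_fin, abs_inv] at this
  rw [Real.fourier_eq, Real.fourier_eq, ← this]
  congr with v
  rw [inner_smul_left, inner_smul_right]
  congr 3
  simp [ha]

/-- The function `x ↦ e^{-2πi x·η} f(x)`. -/
def modulate (η : E d) (f : L2 d) : L2 d :=
  toL2 fun x => (Real.fourierChar (-inner ℝ x η) : ℂ) * f x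

theorem memLp_modulate (η : E d) (f : L2 d) :
    MemLp (fun x => (Real.fourierChar (-inner ℝ x η) : ℂ) * f x) 2 (volume : Measure (E d)) := by
  refine (Lp.memLp f).of_le (.mul (Continuous.aestronglyMeasurable ?_) (Lp.aestronglyMeasurable f))
    (.of_forall fun x => by rw [norm_mul, Circle.norm_coe, one_mul])
  exact continuous_subtype_val.comp (Real.continuous_fourierChar.comp (by fun_prop))

theorem memLp_comp_add {u : E d → ℂ} (hu : MemLp u 2 (volume : Measure (E d))) (a : E d) :
    MemLp (fun x => u (x + a)) 2 (volume : Measure (E d)) :=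
  hu.comp_measurePreserving (measurePreserving_add_right volume a)

/-- By duality, modulating `f` is translating the transform of the test function, hence translating
the test function on the other side. -/
theorem fourier_modulate (η : E d) (f : L2 d) :
    (𝓕 (modulate η f) : L2 d) =ᵐ[volume] fun ζ => (𝓕 f : L2 d) (ζ + η) := by
  refine fourier_ae_eq_of_forall _ ((memLp_comp_add (Lp.memLp (𝓕 f : L2 d)) η).locallyIntegrable
    (by norm_num)) fun g _ => ?_
  have h := integral_fourier_mul_eq f (SchwartzMap.compSubConstCLM ℂ η g)
  have e1 : ∫ x, (𝓕 g) x * modulate η f x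
      = ∫ x, (𝓕 (SchwartzMap.compSubConstCLM ℂ η g)) x * f x := by
    refine integral_congr_ae ?_
    filter_upwards [toL2_coeFn (memLp_modulate η f)] with x hx
    rw [modulate, hx, SchwartzMap.fourier_coe, SchwartzMap.fourier_coe]
    have := fourier_comp_sub g η x
    simp only [Circle.smul_def, smul_eq_mul] at this
    change _ = 𝓕 (fun y => g (y - η)) x * _
    rw [this, real_inner_comm]; ring
  rw [e1, h, ← integral_sub_right_eq_self (fun x => g x * (𝓕 f : L2 d) (x + η)) η]
  simp

theorem fourier_dilate {a : ℝ} (ha : a ≠ 0) (f : L2 d) :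
    (𝓕 (dilate a f) : L2 d) =ᵐ[volume]
      fun η => (|a ^ d|⁻¹ : ℝ) • (𝓕 f : L2 d) (a⁻¹ • η) := by
  have hv : MemLp (fun η => (|a ^ d|⁻¹ : ℝ) • (𝓕 f : L2 d) (a⁻¹ • η)) 2
      (volume : Measure (E d)) :=
    MemLp.const_smul (memLp_comp_smul (inv_ne_zero ha) (Lp.memLp (𝓕 f : L2 d))) (|a ^ d|⁻¹ : ℝ)
  refine fourier_ae_eq_of_forall _ (hv.locallyIntegrable (by norm_num)) fun g _ => ?_
  set ga : 𝓢(E d, ℂ) := SchwartzMap.compCLMOfContinuousLinearEquiv ℂ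
    (ContinuousLinearEquiv.smulLeft (Units.mk0 a ha)) g with hga
  have hga' : ∀ x, ga x = g (a • x) := fun x => rfl
  have h := integral_fourier_mul_eq f ga
  have hpos : |a ^ d| ≠ 0 := by positivity
  have e1 : ∫ x, (𝓕 g) x * dilate a f x = ∫ x, (𝓕 ga) x * f x := by
    have h1 := Measure.integral_comp_smul volume (fun x : E d => (𝓕 g) (a⁻¹ • x) * f x) a
    simp only [finrank_euclideanSpace, Fintype.card_fin, smul_smul, inv_mul_cancel₀ ha, one_smul,
      abs_inv] at h1
    rw [← integral_smul] at h1
    refine (integral_congr_ae ?_).trans (h1.trans (integral_congr_ae (.of_forall fun x => ?_)))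
    · filter_upwards [toL2_coeFn (memLp_dilate ha f)] with x hx
      rw [dilate, hx]
    · simp only
      rw [SchwartzMap.fourier_coe, SchwartzMap.fourier_coe,
        show (ga : E d → ℂ) = fun y => g (a • y) from funext hga', fourier_comp_smul g ha x,
        smul_mul_assoc]
  rw [e1, h]
  have h2 := Measure.integral_comp_smul volume
    (fun x : E d => g x * (𝓕 f : L2 d) (a⁻¹ • x)) a
  simp only [finrank_euclideanSpace, Fintype.card_fin, smul_smul, inv_mul_cancel₀ ha, one_smul,
      abs_inv] at h2
  rw [← integral_smul] at h2
  simp only [hga', h2, mul_smul_comm]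

/-! ### The transforms `hat` and `invHat` -/

theorem ae_comp_smul {a : ℝ} (ha : a ≠ 0) {p : E d → Prop} (h : ∀ᵐ x, p x) :
    ∀ᵐ x : E d, p (a • x) := by
  have : Measure.QuasiMeasurePreserving (fun x : E d => a • x) volume volume := by
    refine ⟨measurable_const_smul a, ?_⟩
    rw [Measure.map_addHaar_smul volume ha]
    exact Measure.smul_absolutelyContinuous
  exact this.ae h

theorem hat_invHat {h : E d → ℂ} (hh : MemLp h 2 (volume : Measure (E d))) :
    hat (invHat h) =ᵐ[volume] h := by
  have hπ : (2 * Real.pi) ≠ 0 := by positivity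
  have h1 := toL2_coeFn (memLp_comp_smul hπ hh)
  unfold hat invHat
  rw [fourier_fourierInv_eq]
  filter_upwards [ae_comp_smul (inv_ne_zero hπ) h1] with x hx
  rw [hx, smul_smul, mul_inv_cancel₀ hπ, one_smul]

theorem stronglyMeasurable_hat (f : L2 d) : StronglyMeasurable (hat f) :=
  (Lp.stronglyMeasurable _).comp_measurable (measurable_const_smul _)

theorem hat_ae_eq_of_fourier {f : L2 d} {v : E d → ℂ} (h : (𝓕 f : L2 d) =ᵐ[volume] v) :
    hat f =ᵐ[volume] fun ξ => v ((2 * Real.pi)⁻¹ • ξ) :=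
  ae_comp_smul (by positivity) h

/-- The random coefficients are real, whereas linearity of the Fourier isometry is used over ℂ. -/
theorem real_smul_eq (x : ℝ) (a : L2 d) : x • a = (x : ℂ) • a := by
  refine Lp.ext ?_
  filter_upwards [Lp.coeFn_smul x a, Lp.coeFn_smul (x : ℂ) a] with ξ h1 h2
  rw [h1, h2]
  simp

theorem hat_sum_smul {ι : Type*} (t : Finset ι) (x : ι → ℝ) (a : ι → L2 d) :
    hat (∑ n ∈ t, x n • a n) =ᵐ[volume] fun ξ => ∑ n ∈ t, x n • hat (a n) ξ := by
  refine hat_ae_eq_of_fourier (v := fun ξ => ∑ n ∈ t, x n • (𝓕 (a n) : L2 d) ξ) ?_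
  have : (𝓕 (∑ n ∈ t, x n • a n) : L2 d) = ∑ n ∈ t, x n • (𝓕 (a n) : L2 d) := by
    change Lp.fourierTransformₗᵢ (E d) ℂ _ = ∑ n ∈ t, x n • Lp.fourierTransformₗᵢ (E d) ℂ (a n)
    rw [map_sum]
    refine Finset.sum_congr rfl fun n _ => ?_
    rw [real_smul_eq, real_smul_eq, map_smul]
  rw [this]
  refine (Lp.coeFn_finsetSum _ _).trans ?_
  have h2 : ∀ᵐ ξ, ∀ n ∈ t, (x n • (𝓕 (a n) : L2 d) : L2 d) ξ = x n • (𝓕 (a n) : L2 d) ξ :=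
    (Finset.eventually_all t).2 fun n _ => Lp.coeFn_smul _ _
  filter_upwards [h2] with ξ hξ
  simp only [Finset.sum_apply]
  exact Finset.sum_congr rfl hξ

theorem hat_fourierMult {m : E d → ℝ} (hm : Measurable m) {B : ℝ} (hB : ∀ x, |m x| ≤ B)
    (f : L2 d) : hat (fourierMult m f) =ᵐ[volume] fun ξ => (m ξ : ℂ) * hat f ξ :=
  hat_invHat (memLp_mul_of_bound hm hB (memLp_hat f))

theorem hat_dilate {a : ℝ} (ha : a ≠ 0) (f : L2 d) :
    hat (dilate a f) =ᵐ[volume] fun ξ => (|a ^ d|⁻¹ : ℝ) • hat f (a⁻¹ • ξ) := by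
  refine (hat_ae_eq_of_fourier (fourier_dilate ha f)).trans (.of_forall fun ξ => ?_)
  simp only [hat, smul_smul, mul_comm]

theorem hat_angPiece {Y : Sph d → ℂ} (hY : Continuous Y) (g : L2 d) :
    hat (angPiece Y g) =ᵐ[volume] polarFun (angCoeff (hat g) Y) Y :=
  hat_invHat (memLp_angPiece hY g)

/-! ### The unit-scale partition of unity -/

theorem latticePt_apply (i : Fin d → ℤ) (n : Fin d) : latticePt i n = (i n : ℝ) := rfl

theorem latticePt_sub (i j : Fin d → ℤ) : latticePt (i - j) = latticePt i - latticePt j := by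
  ext n; simp [latticePt_apply]

/-- A finite set that contains the lattice points at distance at most `R` from `x`. -/
def nearLattice (R : ℝ) (x : E d) : Finset (Fin d → ℤ) :=
  Fintype.piFinset fun n => Finset.Icc ⌈x n - R⌉ ⌊x n + R⌋

theorem mem_nearLattice {R : ℝ} {x : E d} {i : Fin d → ℤ} (h : ‖x - latticePt i‖ ≤ R) :
    i ∈ nearLattice R x := by
  refine Fintype.mem_piFinset.2 fun n => ?_
  have h1 : |x n - i n| ≤ R := (PiLp.norm_apply_le (x - latticePt i) n).trans h
  rw [abs_le] at h1
  rw [Finset.mem_Icc, Int.ceil_le, Int.le_floor]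
  constructor <;> linarith

theorem card_nearLattice_le {R : ℝ} (hR : 0 ≤ R) (x : E d) :
    (nearLattice R x).card ≤ (⌊2 * R⌋₊ + 1) ^ d := by
  rw [nearLattice, Fintype.card_piFinset]
  refine (Finset.prod_le_pow_card _ _ (⌊2 * R⌋₊ + 1) fun n _ => ?_).trans (by simp)
  rw [Int.card_Icc]
  have h1 : (⌊x n + R⌋ : ℝ) ≤ x n + R := Int.floor_le _
  have h2 : x n - R ≤ (⌈x n - R⌉ : ℝ) := Int.le_ceil _
  have h3 : ⌊x n + R⌋ - ⌈x n - R⌉ ≤ ⌊2 * R⌋ := by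
    rw [Int.le_floor]; push_cast; linarith
  have h4 : (⌊2 * R⌋ : ℤ) = ((⌊2 * R⌋₊ : ℕ) : ℤ) := (Int.natCast_floor_eq_floor (by positivity)).symm
  omega

/-- Round each coordinate. The radius `√d` is the one on which the bump equals one, so the
denominator of `unitCut` is at least one. -/
theorem exists_latticePt_near (x : E d) : ∃ i : Fin d → ℤ, ‖x - latticePt i‖ ≤ √(d : ℝ) := by
  refine ⟨fun n => round (x n), ?_⟩
  rw [EuclideanSpace.norm_eq]
  refine Real.sqrt_le_sqrt ?_
  calc ∑ n, ‖(x - latticePt fun n => round (x n)) n‖ ^ 2 ≤ ∑ _n : Fin d, (1 : ℝ) := by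
        refine Finset.sum_le_sum fun n _ => ?_
        have : |x n - round (x n)| ≤ 1 / 2 := abs_sub_round (x n)
        rw [PiLp.sub_apply, latticePt_apply, Real.norm_eq_abs]
        nlinarith [abs_nonneg (x n - round (x n))]
    _ = d := by simp

/-- The lattice translates of balls of radius `R` have bounded overlap. -/
theorem tsum_indicator_ball_le {R : ℝ} (hR : 0 ≤ R) (x : E d) :
    ∑' i : Fin d → ℤ, (Metric.closedBall (latticePt i) R).indicator (1 : E d → ℝ≥0∞) x
      ≤ ((⌊2 * R⌋₊ + 1) ^ d : ℕ) := by
  rw [tsum_eq_sum (s := nearLattice R x) fun i hi => Set.indicator_of_notMem (fun h => hi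
    (mem_nearLattice (by simpa [dist_eq_norm] using h))) _]
  refine (Finset.sum_le_card_nsmul _ _ (1 : ℝ≥0∞) fun i _ => by
    unfold Set.indicator; split_ifs <;> simp).trans ?_
  rw [nsmul_eq_mul, mul_one]
  exact_mod_cast card_nearLattice_le hR x

variable {φ : E d → ℝ}

theorem IsUnitBump.eq_zero_of_notMem (hφ : IsUnitBump φ) {R : ℝ} (hR : 2 * √(d : ℝ) ≤ R) {x : E d}
    {k : Fin d → ℤ} (hk : k ∉ nearLattice R x) : φ (x - latticePt k) = 0 :=
  hφ.eq_zero _ (hR.trans (not_le.1 fun h => hk (mem_nearLattice h)).le)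

theorem IsUnitBump.summable (hφ : IsUnitBump φ) (x : E d) :
    Summable fun k : Fin d → ℤ => φ (x - latticePt k) :=
  summable_of_ne_finset_zero (s := nearLattice (2 * √(d : ℝ)) x)
    fun _ hk => hφ.eq_zero_of_notMem le_rfl hk

theorem IsUnitBump.one_le_tsum (hφ : IsUnitBump φ) (x : E d) :
    1 ≤ ∑' k : Fin d → ℤ, φ (x - latticePt k) := by
  obtain ⟨i, hi⟩ := exists_latticePt_near x
  rw [← hφ.eq_one _ hi]
  exact (hφ.summable x).le_tsum i fun k _ => hφ.nonneg _

theorem IsUnitBump.contDiff_tsum (hφ : IsUnitBump φ) :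
    ContDiff ℝ (⊤ : ℕ∞) fun x => ∑' k : Fin d → ℤ, φ (x - latticePt k) := by
  refine contDiff_iff_contDiffAt.2 fun x₀ => ?_
  -- The extra `1` in the radius makes one finite set serve all points of the unit ball around `x₀`.
  set s := nearLattice (2 * √(d : ℝ) + 1) x₀
  have h : (fun x => ∑' k : Fin d → ℤ, φ (x - latticePt k))
      =ᶠ[𝓝 x₀] fun x => ∑ k ∈ s, φ (x - latticePt k) := by
    filter_upwards [Metric.ball_mem_nhds x₀ one_pos] with x hx
    refine tsum_eq_sum fun k hk => hφ.eq_zero _ ?_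
    have h1 : 2 * √(d : ℝ) + 1 < ‖x₀ - latticePt k‖ := not_le.1 fun h => hk (mem_nearLattice h)
    have h2 := norm_sub_norm_le (x₀ - latticePt k) (x₀ - x)
    rw [sub_sub_sub_cancel_left] at h2
    have h3 : ‖x₀ - x‖ < 1 := by rwa [← dist_eq_norm, dist_comm]
    linarith
  refine ContDiffAt.congr_of_eventuallyEq (ContDiff.contDiffAt ?_) h
  exact ContDiff.sum fun k _ => hφ.smooth.comp (contDiff_id.sub contDiff_const)

/-- The denominator is invariant under lattice translations. All cuts are therefore translates of
one Schwartz function, and one constant serves every cell. -/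
theorem unitCut_eq_comp_sub (φ : E d → ℝ) (i : Fin d → ℤ) (x : E d) :
    unitCut φ i x = unitCut φ 0 (x - latticePt i) := by
  have h0 : latticePt (0 : Fin d → ℤ) = 0 := by ext n; simp [latticePt_apply]
  unfold unitCut
  rw [h0, sub_zero, ← (Equiv.subRight i).tsum_eq fun k => φ (x - latticePt i - latticePt k)]
  simp [latticePt_sub]

theorem IsUnitBump.contDiff_unitCut (hφ : IsUnitBump φ) (i : Fin d → ℤ) :
    ContDiff ℝ (⊤ : ℕ∞) (unitCut φ i) :=
  (hφ.smooth.comp (contDiff_id.sub contDiff_const)).div hφ.contDiff_tsum fun x =>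
    (zero_lt_one.trans_le (hφ.one_le_tsum x)).ne'

theorem IsUnitBump.unitCut_eq_zero (hφ : IsUnitBump φ) {i : Fin d → ℤ} {x : E d}
    (hx : x ∉ Metric.closedBall (latticePt i) (2 * √(d : ℝ))) : unitCut φ i x = 0 := by
  rw [unitCut, hφ.eq_zero _ (by simpa [dist_eq_norm] using (not_le.1 hx).le), zero_div]

theorem IsUnitBump.unitCut_nonneg (hφ : IsUnitBump φ) (i : Fin d → ℤ) (x : E d) :
    0 ≤ unitCut φ i x :=
  div_nonneg (hφ.nonneg _) (tsum_nonneg fun _ => hφ.nonneg _)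

/-- The cuts lie between zero and one and sum to one, and squaring only decreases them. -/
theorem IsUnitBump.tsum_enorm_unitCut_sq_le (hφ : IsUnitBump φ) (x : E d) :
    ∑' i : Fin d → ℤ, ‖unitCut φ i x‖ₑ ^ 2 ≤ 1 := by
  have hle : ∀ i, ‖unitCut φ i x‖ₑ ^ 2 ≤ ENNReal.ofReal (unitCut φ i x) := by
    intro i
    have h1 : ‖unitCut φ i x‖ₑ = ENNReal.ofReal (unitCut φ i x) :=
      Real.enorm_of_nonneg (hφ.unitCut_nonneg i x)
    have h2 : ‖unitCut φ i x‖ₑ ≤ 1 := by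
      rw [h1, ENNReal.ofReal_le_one]
      exact (le_abs_self _).trans (abs_unitCut_le hφ i x)
    rw [pow_two, ← h1]
    exact mul_le_of_le_one_left' h2
  refine (ENNReal.tsum_le_tsum hle).trans ?_
  have hs : Summable fun i => unitCut φ i x := (hφ.summable x).div_const _
  rw [← ENNReal.ofReal_tsum_of_nonneg (fun i => hφ.unitCut_nonneg i x) hs]
  refine ENNReal.ofReal_le_one.2 (le_of_eq ?_)
  simp only [unitCut]
  rw [tsum_div_const, div_self (zero_lt_one.trans_le (hφ.one_le_tsum x)).ne']

/-- The bump `φ_0` as a Schwartz function. -/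
def IsUnitBump.schwartz (hφ : IsUnitBump φ) : SchwartzMap (E d) ℂ :=
  HasCompactSupport.toSchwartzMap (f := Complex.ofRealCLM ∘ unitCut φ 0)
    ((HasCompactSupport.intro (isCompact_closedBall _ _) fun _ hx =>
      hφ.unitCut_eq_zero hx).comp_left rfl)
    (Complex.ofRealCLM.contDiff.comp (hφ.contDiff_unitCut 0))

theorem IsUnitBump.schwartz_apply (hφ : IsUnitBump φ) (x : E d) :
    hφ.schwartz x = (unitCut φ 0 x : ℂ) := rfl

open scoped SchwartzMap Laplacian

/-! ### Localisation to unit balls in Sobolev spaces -/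

theorem lintegral_enorm_sq {α F : Type*} [MeasurableSpace α] [NormedAddCommGroup F]
    (u : α → F) (μ : Measure α) : ∫⁻ x, ‖u x‖ₑ ^ 2 ∂μ = eLpNorm u 2 μ ^ 2 := by
  have h := eLpNorm_nnreal_pow_eq_lintegral (f := u) (μ := μ) (p := 2) (by norm_num)
  simpa using h.symm

theorem lintegral_enorm_fourierInv_sq (f : L2 d) :
    ∫⁻ x, ‖(𝓕⁻ f : L2 d) x‖ₑ ^ 2 = ∫⁻ x, ‖f x‖ₑ ^ 2 := by
  rw [lintegral_enorm_sq, lintegral_enorm_sq, ← Lp.enorm_def, ← Lp.enorm_def, ← ofReal_norm,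
    ← ofReal_norm, show ‖(𝓕⁻ f : L2 d)‖ = ‖f‖ from (Lp.fourierTransformₗᵢ (E d) ℂ).symm.norm_map f]

/-- Multiplication by `1 + ‖ζ‖²` on the Fourier side does not enlarge the support. -/
theorem exists_schwartz_fourierInv_eq {K : Set (E d)} (hK : IsClosed K) (ψ : 𝓢(E d, ℂ))
    (hψ : ∀ x ∉ K, ψ x = 0) (N : ℕ) :
    ∃ ψ' : 𝓢(E d, ℂ), (∀ x ∉ K, ψ' x = 0) ∧
      ∀ ζ, (𝓕⁻ ψ' : 𝓢(E d, ℂ)) ζ = (((1 + ‖ζ‖ ^ 2) ^ N : ℝ) : ℂ) * (𝓕⁻ ψ : 𝓢(E d, ℂ)) ζ := by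
  suffices ∃ ψ' : 𝓢(E d, ℂ), (∀ x ∉ K, ψ' x = 0) ∧
      ∀ ζ, (𝓕 ψ' : 𝓢(E d, ℂ)) ζ = (((1 + ‖ζ‖ ^ 2) ^ N : ℝ) : ℂ) * (𝓕 ψ : 𝓢(E d, ℂ)) ζ by
    obtain ⟨ψ', h1, h2⟩ := this
    refine ⟨ψ', h1, fun ζ => ?_⟩
    have := h2 (-ζ)
    rw [norm_neg] at this
    rw [SchwartzMap.fourierInv_coe, SchwartzMap.fourierInv_coe, Real.fourierInv_eq_fourier_neg,
      Real.fourierInv_eq_fourier_neg]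
    exact this
  induction N with
  | zero => exact ⟨ψ, hψ, fun ζ => by simp⟩
  | succ N ih =>
    obtain ⟨ψ', h1, h2⟩ := ih
    -- For the kernel `e^{-2πi x·ζ}`, the operator `1 - (2π)⁻² Δ` has symbol `1 + |ζ|²`; being
    -- differential, it does not enlarge supports.
    refine ⟨ψ' - ((2 * Real.pi) ^ 2)⁻¹ • Δ ψ', fun x hx => ?_, fun ζ => ?_⟩
    · have h3 : (ψ' : E d → ℂ) =ᶠ[𝓝 x] fun _ => 0 := by
        filter_upwards [hK.isOpen_compl.mem_nhds hx] with y hy using h1 y hy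
      rw [sub_apply, smul_apply, SchwartzMap.laplacian_apply, h1 x hx,
        (InnerProductSpace.laplacian_congr_nhds h3).eq_of_nhds]
      simp
    · have h3 : 𝓕 (Δ ψ') = -(2 * Real.pi) ^ 2 • SchwartzMap.smulLeftCLM ℂ (‖·‖ ^ 2) (𝓕 ψ') := by
        rw [SchwartzMap.laplacian_eq_fourierMultiplierCLM, SchwartzMap.fourierMultiplierCLM_apply,
          FourierTransform.fourier_smul, FourierTransform.fourier_fourierInv_eq]
      have h4 : 𝓕 (ψ' - ((2 * Real.pi) ^ 2)⁻¹ • Δ ψ')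
          = 𝓕 ψ' - ((2 * Real.pi) ^ 2)⁻¹ • 𝓕 (Δ ψ') := by
        rw [sub_eq_add_neg, FourierTransform.fourier_add, FourierTransform.fourier_neg,
          FourierTransform.fourier_smul, sub_eq_add_neg]
      rw [h4, h3, sub_apply, smul_apply, smul_apply,
        SchwartzMap.smulLeftCLM_apply_apply (by fun_prop), h2]
      have hπ : (Real.pi : ℂ) ≠ 0 := by exact_mod_cast Real.pi_ne_zero
      simp
      field_simp
      ring

theorem memLp_japanese_mul (N : ℕ) (η : E d) (f : L2 d) :
    MemLp (fun ζ : E d => ((((1 + ‖ζ‖ ^ 2) ^ N)⁻¹ : ℝ) : ℂ) * (𝓕 f : L2 d) (ζ + η)) 2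
      (volume : Measure (E d)) := by
  refine memLp_mul_of_bound (by fun_prop) (B := 1) (fun ζ => ?_)
    (memLp_comp_add (Lp.memLp (𝓕 f : L2 d)) η)
  rw [abs_of_nonneg (by positivity)]
  exact inv_le_one_of_one_le₀ (one_le_pow₀ (by nlinarith [sq_nonneg ‖ζ‖]))

theorem enorm_integral_mul_sq_le {α : Type*} [MeasurableSpace α] {μ : Measure α} {u v : α → ℂ}
    (hu : AEStronglyMeasurable u μ) (hv : AEStronglyMeasurable v μ) {B : Set α}
    (h : ∀ x ∉ B, u x = 0) :
    ‖∫ x, u x * v x ∂μ‖ₑ ^ 2 ≤ (∫⁻ x, ‖u x‖ₑ ^ 2 ∂μ) * ∫⁻ x in B, ‖v x‖ₑ ^ 2 ∂μ := by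
  have h1 : ∫ x, u x * v x ∂μ = ∫ x in B, u x * v x ∂μ :=
    (setIntegral_eq_integral_of_forall_compl_eq_zero fun x hx => by simp [h x hx]).symm
  have h2 := ENNReal.lintegral_mul_le_Lp_mul_Lq (μ.restrict B) Real.HolderConjugate.two_two
    hu.restrict.enorm hv.restrict.enorm
  have h3 : ‖∫ x in B, u x * v x ∂μ‖ₑ ≤ ∫⁻ x in B, ‖u x‖ₑ * ‖v x‖ₑ ∂μ := by
    refine (enorm_integral_le_lintegral_enorm _).trans (le_of_eq ?_)
    simp
  rw [h1]
  calc ‖∫ x in B, u x * v x ∂μ‖ₑ ^ 2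
      ≤ ((∫⁻ x in B, ‖u x‖ₑ ^ (2 : ℝ) ∂μ) ^ (1 / (2 : ℝ)) *
        (∫⁻ x in B, ‖v x‖ₑ ^ (2 : ℝ) ∂μ) ^ (1 / (2 : ℝ))) ^ 2 := by
        gcongr; exact h3.trans h2
    _ = (∫⁻ x in B, ‖u x‖ₑ ^ 2 ∂μ) * ∫⁻ x in B, ‖v x‖ₑ ^ 2 ∂μ := by
        rw [mul_pow, ← ENNReal.rpow_natCast, ← ENNReal.rpow_natCast, ← ENNReal.rpow_mul,
          ← ENNReal.rpow_mul]
        simp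
    _ ≤ _ := by gcongr; exact Measure.restrict_le_self

/-- The left side pairs the translate of `ψ` with the modulated `f`. On the Fourier side insert `(1
+ |ζ|²)^N` and its inverse: the first turns `ψ` into `ψ'`, still supported in the ball, and the
second smooths the modulated `f`. Cauchy-Schwarz on the ball concludes. The smoothed function does
not depend on `a`, so the bounds can be summed over lattice translates. -/
theorem enorm_fourier_mul_sq_le {ψ ψ' : 𝓢(E d, ℂ)} {R : ℝ} {N : ℕ}
    (hR : ∀ x ∉ Metric.closedBall (0 : E d) R, ψ' x = 0)
    (hψ : ∀ ζ, (𝓕⁻ ψ' : 𝓢(E d, ℂ)) ζ = (((1 + ‖ζ‖ ^ 2) ^ N : ℝ) : ℂ) * (𝓕⁻ ψ : 𝓢(E d, ℂ)) ζ) (a η : E d) (f : L2 d) :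
    ‖𝓕 (fun x => ψ (x - a) * f x) η‖ₑ ^ 2 ≤ (∫⁻ x, ‖ψ' x‖ₑ ^ 2) *
      ∫⁻ x in Metric.closedBall a R, ‖(𝓕⁻ (toL2 fun ζ : E d =>
        ((((1 + ‖ζ‖ ^ 2) ^ N)⁻¹ : ℝ) : ℂ) * (𝓕 f : L2 d) (ζ + η)) : L2 d) x‖ₑ ^ 2 := by
  set H : L2 d := toL2 fun ζ : E d =>
    ((((1 + ‖ζ‖ ^ 2) ^ N)⁻¹ : ℝ) : ℂ) * (𝓕 f : L2 d) (ζ + η) with hH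
  set ψa := SchwartzMap.compSubConstCLM ℂ a ψ
  set ψa' := SchwartzMap.compSubConstCLM ℂ a ψ'
  have hF : ∀ ζ, (𝓕⁻ ψa' : 𝓢(E d, ℂ)) ζ = (((1 + ‖ζ‖ ^ 2) ^ N : ℝ) : ℂ) * (𝓕⁻ ψa : 𝓢(E d, ℂ)) ζ := by
    intro ζ
    rw [SchwartzMap.fourierInv_coe, SchwartzMap.fourierInv_coe]
    refine (fourierInv_comp_sub ψ' a ζ).trans ?_
    refine Eq.trans ?_ (congrArg _ (fourierInv_comp_sub ψ a ζ).symm)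
    rw [← SchwartzMap.fourierInv_coe, hψ, SchwartzMap.fourierInv_coe, mul_smul_comm]
  have e1 : 𝓕 (fun x => ψ (x - a) * f x) η = ∫ x, (𝓕 (𝓕⁻ ψa)) x * modulate η f x := by
    rw [Real.fourier_eq]
    refine integral_congr_ae ?_
    filter_upwards [toL2_coeFn (memLp_modulate η f)] with x hx
    rw [modulate, hx, FourierTransform.fourier_fourierInv_eq, SchwartzMap.compSubConstCLM_apply,
      Circle.smul_def, smul_eq_mul]
    ring
  have e2 : ∫ x, (𝓕 (𝓕⁻ ψa)) x * modulate η f x = ∫ x, (𝓕⁻ ψa') x * H x := by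
    rw [integral_fourier_mul_eq]
    refine integral_congr_ae ?_
    filter_upwards [fourier_modulate η f, toL2_coeFn (memLp_japanese_mul N η f)] with x h1 h2
    rw [h1, hH, h2, hF]
    have : (((1 + ‖x‖ ^ 2) ^ N : ℝ) : ℂ) ≠ 0 := by
      exact_mod_cast (by positivity : (1 + ‖x‖ ^ 2) ^ N ≠ 0)
    rw [Complex.ofReal_inv]
    field_simp
  rw [e1, e2, integral_fourierInv_mul_eq]
  refine (enorm_integral_mul_sq_le ψa'.continuous.aestronglyMeasurable
    (Lp.aestronglyMeasurable _) (B := Metric.closedBall a R)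
    fun x hx => hR (x - a) (by simpa [dist_eq_norm] using hx)).trans (le_of_eq ?_)
  congr 1
  exact lintegral_sub_right_eq_self (fun x => ‖ψ' x‖ₑ ^ 2) a

/-- Almost orthogonality of the localised pieces, pointwise on the Fourier side. -/
theorem tsum_enorm_fourier_unitCut_sq_le {φ : E d → ℝ} (hφ : IsUnitBump φ) (N : ℕ) :
    ∃ A : ℝ≥0∞, A ≠ ∞ ∧ ∀ (f : L2 d) (η : E d),
      ∑' i : Fin d → ℤ, ‖𝓕 (fun x => (unitCut φ i x : ℂ) * f x) η‖ₑ ^ 2 ≤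
        A * ∫⁻ ζ, ENNReal.ofReal ((1 + ‖ζ‖ ^ 2) ^ N)⁻¹ ^ 2 * ‖(𝓕 f : L2 d) (ζ + η)‖ₑ ^ 2 := by
  obtain ⟨ψ', hR, hψ⟩ := exists_schwartz_fourierInv_eq
    (Metric.isClosed_closedBall (x := (0 : E d)) (ε := 2 * √(d : ℝ))) hφ.schwartz
    (fun x hx => by
      have h0 : latticePt (0 : Fin d → ℤ) = 0 := by ext n; simp [latticePt_apply]
      rw [hφ.schwartz_apply, hφ.unitCut_eq_zero (by rwa [h0]), Complex.ofReal_zero]) N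
  -- The constant is the squared `L²` norm of `ψ'` times the overlap number of the balls of radius
  -- `2√d`.
  refine ⟨(∫⁻ x, ‖ψ' x‖ₑ ^ 2) * ((⌊2 * (2 * √(d : ℝ))⌋₊ + 1) ^ d : ℕ),
    ENNReal.mul_ne_top ?_ (ENNReal.natCast_ne_top _), fun f η => ?_⟩
  · rw [lintegral_enorm_sq]
    exact ENNReal.pow_ne_top (ψ'.memLp 2 volume).eLpNorm_ne_top
  set H : L2 d := toL2 fun ζ : E d =>
    ((((1 + ‖ζ‖ ^ 2) ^ N)⁻¹ : ℝ) : ℂ) * (𝓕 f : L2 d) (ζ + η) with hH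
  have hHm : Measurable fun x => ‖(𝓕⁻ H : L2 d) x‖ₑ ^ 2 :=
    (Lp.stronglyMeasurable _).enorm.pow_const _
  calc ∑' i : Fin d → ℤ, ‖𝓕 (fun x => (unitCut φ i x : ℂ) * f x) η‖ₑ ^ 2
      ≤ ∑' i : Fin d → ℤ, (∫⁻ x, ‖ψ' x‖ₑ ^ 2) *
        ∫⁻ x in Metric.closedBall (latticePt i) (2 * √(d : ℝ)), ‖(𝓕⁻ H : L2 d) x‖ₑ ^ 2 := by
        refine ENNReal.tsum_le_tsum fun i => ?_
        refine le_trans (le_of_eq ?_) (enorm_fourier_mul_sq_le hR hψ (latticePt i) η f)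
        simp only [hφ.schwartz_apply, ← unitCut_eq_comp_sub]
    _ = (∫⁻ x, ‖ψ' x‖ₑ ^ 2) * ∫⁻ x, (∑' i : Fin d → ℤ,
        (Metric.closedBall (latticePt i) (2 * √(d : ℝ))).indicator (1 : E d → ℝ≥0∞) x) *
          ‖(𝓕⁻ H : L2 d) x‖ₑ ^ 2 := by
        rw [ENNReal.tsum_mul_left]
        congr 1
        simp_rw [← ENNReal.tsum_mul_right]
        rw [lintegral_tsum fun i => by
          exact ((measurable_one.indicator measurableSet_closedBall).mul hHm).aemeasurable]
        refine tsum_congr fun i => ?_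
        rw [← lintegral_indicator measurableSet_closedBall]
        refine lintegral_congr fun x => ?_
        by_cases hx : x ∈ Metric.closedBall (latticePt i) (2 * √(d : ℝ))
        · rw [Set.indicator_of_mem hx, Set.indicator_of_mem hx, Pi.one_apply, one_mul]
        · rw [Set.indicator_of_notMem hx, Set.indicator_of_notMem hx, zero_mul]
    _ ≤ (∫⁻ x, ‖ψ' x‖ₑ ^ 2) * ∫⁻ x, ((⌊2 * (2 * √(d : ℝ))⌋₊ + 1) ^ d : ℕ) *
          ‖(𝓕⁻ H : L2 d) x‖ₑ ^ 2 := by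
        gcongr with x
        exact tsum_indicator_ball_le (by positivity) x
    _ = _ := by
        rw [lintegral_const_mul _ hHm, lintegral_enorm_fourierInv_sq, mul_assoc]
        congr 2
        refine lintegral_congr_ae ?_
        filter_upwards [toL2_coeFn (memLp_japanese_mul N η f)] with ζ hζ
        rw [hH, hζ, enorm_mul, mul_pow, ← ofReal_norm, Complex.norm_real,
          Real.norm_of_nonneg (by positivity)]

/-! ### Weighted norms -/

/-- `∫ W |f̂|²`. -/
def weightedSq (W : E d → ℝ≥0∞) (f : L2 d) : ℝ≥0∞ := ∫⁻ ξ, W ξ * ‖hat f ξ‖ₑ ^ 2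

/-- The weight of the norm of `H^s`. -/
def sobolevWeight (s : ℝ) (ξ : E d) : ℝ≥0∞ := ‖((1 + ‖ξ‖ ^ 2) ^ (s / 2) : ℝ)‖ₑ ^ 2

/-- The weight of the norm of `Ḣ^s`. -/
def homSobolevWeight (s : ℝ) (ξ : E d) : ℝ≥0∞ := ‖(‖ξ‖ ^ s : ℝ)‖ₑ ^ 2

theorem measurable_sobolevWeight (s : ℝ) : Measurable (sobolevWeight s : E d → ℝ≥0∞) := by
  unfold sobolevWeight
  fun_prop

theorem measurable_homSobolevWeight (s : ℝ) : Measurable (homSobolevWeight s : E d → ℝ≥0∞) := by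
  unfold homSobolevWeight
  fun_prop

theorem sobolevNorm_sq (s : ℝ) (f : L2 d) :
    sobolevNorm s f ^ 2 = weightedSq (sobolevWeight s) f := by
  rw [sobolevNorm, ← lintegral_enorm_sq]
  simp only [weightedSq, sobolevWeight, enorm_smul, mul_pow]

theorem homSobolevNorm_sq (s : ℝ) (f : L2 d) :
    homSobolevNorm s f ^ 2 = weightedSq (homSobolevWeight s) f := by
  rw [homSobolevNorm, ← lintegral_enorm_sq]
  simp only [weightedSq, homSobolevWeight, enorm_smul, mul_pow]

theorem weightedSq_congr {W : E d → ℝ≥0∞} {f : L2 d} {v : E d → ℂ} (h : hat f =ᵐ[volume] v) :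
    weightedSq W f = ∫⁻ ξ, W ξ * ‖v ξ‖ₑ ^ 2 := by
  refine lintegral_congr_ae ?_
  filter_upwards [h] with ξ hξ
  rw [hξ]

theorem lintegral_comp_smul {a : ℝ} (ha : a ≠ 0) (g : E d → ℝ≥0∞) :
    ∫⁻ x, g (a • x) = ENNReal.ofReal |a ^ d|⁻¹ * ∫⁻ x, g x := by
  have he : MeasurableEmbedding (fun x : E d => a • x) :=
    (Homeomorph.smulOfNeZero a ha).measurableEmbedding
  rw [← he.lintegral_map, Measure.map_addHaar_smul volume ha, lintegral_smul_measure]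
  simp

theorem weightedSq_eq_fourier (W : E d → ℝ≥0∞) (f : L2 d) :
    weightedSq W f = ENNReal.ofReal |(2 * Real.pi)⁻¹ ^ d|⁻¹ *
      ∫⁻ η, W ((2 * Real.pi) • η) * ‖(𝓕 f : L2 d) η‖ₑ ^ 2 := by
  have hπ : (2 * Real.pi) ≠ 0 := by positivity
  rw [← lintegral_comp_smul (inv_ne_zero hπ)]
  simp only [smul_smul, mul_inv_cancel₀ hπ, one_smul]
  rfl

theorem weightedSq_one (f : L2 d) : weightedSq (fun _ => 1) f =
    ENNReal.ofReal |(2 * Real.pi)⁻¹ ^ d|⁻¹ * ‖f‖ₑ ^ 2 := by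
  rw [weightedSq_eq_fourier]
  simp only [one_mul]
  rw [lintegral_enorm_sq, ← Lp.enorm_def, ← ofReal_norm, Lp.norm_fourier_eq, ofReal_norm]

theorem IsUnitBump.integrable_unitCut_mul {φ : E d → ℝ} (hφ : IsUnitBump φ) (i : Fin d → ℤ)
    (f : L2 d) : Integrable fun x => (unitCut φ i x : ℂ) * f x := by
  have hc : HasCompactSupport fun x => (unitCut φ i x : ℂ) :=
    HasCompactSupport.intro (isCompact_closedBall (latticePt i) (2 * √(d : ℝ))) fun x hx => by
      rw [hφ.unitCut_eq_zero hx, Complex.ofReal_zero]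
  have hcont : Continuous fun x => (unitCut φ i x : ℂ) :=
    Complex.continuous_ofReal.comp (hφ.contDiff_unitCut i).continuous
  exact MemLp.integrable_mul (hcont.memLp_of_hasCompactSupport hc (p := 2)) (Lp.memLp f)

/-- Peetre's inequality: a shift by `ζ` changes the weight by at most a power of `1 + |ζ|²`. The
constant is `80 = 2 · 40`, with `(2π)² ≤ 40`. Since the base exceeds one, the exponent `s` may be
raised to `S`, which makes the bound uniform in `s`. -/
theorem sobolevWeight_le {s S : ℝ} (hs : 0 ≤ s) (hsS : s ≤ S) (ζ η : E d) :
    sobolevWeight s ((2 * Real.pi) • η) ≤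
      ‖((80 * (1 + ‖ζ‖ ^ 2)) ^ (S / 2) : ℝ)‖ₑ ^ 2 * sobolevWeight s ((2 * Real.pi) • (ζ + η)) := by
  unfold sobolevWeight
  rw [← mul_pow, ← enorm_mul]
  gcongr
  rw [Real.enorm_of_nonneg (by positivity), Real.enorm_of_nonneg (by positivity)]
  refine ENNReal.ofReal_le_ofReal ?_
  have hz : 0 ≤ ‖ζ‖ ^ 2 := by positivity
  have h1 : 1 + ‖(2 * Real.pi) • η‖ ^ 2 ≤
      (80 * (1 + ‖ζ‖ ^ 2)) * (1 + ‖(2 * Real.pi) • (ζ + η)‖ ^ 2) := by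
    have h2 : ‖(2 * Real.pi) • η‖ ≤ ‖(2 * Real.pi) • (ζ + η)‖ + ‖(2 * Real.pi) • ζ‖ := by
      have := norm_sub_le ((2 * Real.pi) • (ζ + η)) ((2 * Real.pi) • ζ)
      rwa [← smul_sub, add_sub_cancel_left] at this
    have h3 : ‖(2 * Real.pi) • ζ‖ ^ 2 ≤ 40 * ‖ζ‖ ^ 2 := by
      rw [norm_smul, mul_pow, Real.norm_of_nonneg (by positivity)]
      gcongr
      nlinarith [Real.pi_lt_d2, Real.pi_pos]
    have h4 : ‖(2 * Real.pi) • η‖ ^ 2 ≤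
        2 * ‖(2 * Real.pi) • (ζ + η)‖ ^ 2 + 2 * ‖(2 * Real.pi) • ζ‖ ^ 2 := by
      nlinarith [sq_nonneg (‖(2 * Real.pi) • (ζ + η)‖ - ‖(2 * Real.pi) • ζ‖),
        norm_nonneg ((2 * Real.pi) • η)]
    nlinarith [mul_nonneg hz (sq_nonneg ‖(2 * Real.pi) • (ζ + η)‖),
      sq_nonneg ‖(2 * Real.pi) • (ζ + η)‖]
  calc (1 + ‖(2 * Real.pi) • η‖ ^ 2) ^ (s / 2)
      ≤ ((80 * (1 + ‖ζ‖ ^ 2)) * (1 + ‖(2 * Real.pi) • (ζ + η)‖ ^ 2)) ^ (s / 2) := by gcongr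
    _ = (80 * (1 + ‖ζ‖ ^ 2)) ^ (s / 2) * (1 + ‖(2 * Real.pi) • (ζ + η)‖ ^ 2) ^ (s / 2) :=
        Real.mul_rpow (by positivity) (by positivity)
    _ ≤ _ := by
        gcongr
        nlinarith

theorem lintegral_japanese_ne_top (S : ℝ) (hd : 0 < d) : ∃ N : ℕ,
    ∫⁻ ζ : E d, ‖((80 * (1 + ‖ζ‖ ^ 2)) ^ (S / 2) : ℝ)‖ₑ ^ 2 *
      ENNReal.ofReal ((1 + ‖ζ‖ ^ 2) ^ N)⁻¹ ^ 2 ≠ ∞ := by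
  -- The integrand is at most `80^S (1 + |ζ|²)^{S - 2N}`. This choice makes the exponent at most
  -- `-d`, so the decay is of order `|ζ|^{-2d}`, which is integrable.
  obtain ⟨N, hN⟩ := exists_nat_ge ((S + d) / 2)
  refine ⟨N, ?_⟩
  have hi : Integrable (fun ζ : E d => (80 : ℝ) ^ S * (1 + ‖ζ‖ ^ 2) ^ (-(2 * d : ℝ) / 2)) := by
    refine (integrable_rpow_neg_one_add_norm_sq ?_).const_mul _
    have : (0 : ℝ) < d := by exact_mod_cast hd
    simp only [finrank_euclideanSpace, Fintype.card_fin]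
    linarith
  refine (lt_of_le_of_lt (lintegral_mono fun ζ => ?_) hi.2).ne
  rw [Real.enorm_of_nonneg (by positivity), Real.enorm_of_nonneg (by positivity), ← mul_pow,
    ← ENNReal.ofReal_mul (by positivity), ← ENNReal.ofReal_pow (by positivity)]
  refine ENNReal.ofReal_le_ofReal ?_
  have hp : 0 < 1 + ‖ζ‖ ^ 2 := by positivity
  have h1 : 1 ≤ 1 + ‖ζ‖ ^ 2 := by nlinarith [sq_nonneg ‖ζ‖]
  calc ((80 * (1 + ‖ζ‖ ^ 2)) ^ (S / 2) * ((1 + ‖ζ‖ ^ 2) ^ N)⁻¹) ^ 2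
      = 80 ^ S * ((1 + ‖ζ‖ ^ 2) ^ S * (1 + ‖ζ‖ ^ 2) ^ (-(2 * N : ℝ))) := by
        rw [mul_pow, ← Real.rpow_natCast _ 2, ← Real.rpow_mul (by positivity),
          Real.mul_rpow (by norm_num) hp.le, inv_pow, ← pow_mul, ← Real.rpow_natCast _ (N * 2),
          ← Real.rpow_neg hp.le, mul_assoc]
        push_cast
        rw [div_mul_cancel₀ S two_ne_zero, mul_comm (N : ℝ) 2]
    _ ≤ _ := by
        rw [← Real.rpow_add hp]
        refine mul_le_mul_of_nonneg_left (Real.rpow_le_rpow_of_exponent_le h1 ?_) (by positivity)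
        linarith

/-- The localisation to the unit cells is bounded in `H^s`. -/
theorem tsum_weightedSq_unitCut_le {φ : E d → ℝ} (hφ : IsUnitBump φ) (hd : 0 < d) (S : ℝ) :
    ∃ A : ℝ≥0∞, A ≠ ∞ ∧ ∀ s, 0 ≤ s → s ≤ S → ∀ f : L2 d,
      ∑' i, weightedSq (sobolevWeight s) (mulL2 (unitCut φ i) f) ≤
        A * weightedSq (sobolevWeight s) f := by
  obtain ⟨N, hN⟩ := lintegral_japanese_ne_top S hd
  obtain ⟨A, hA, hAf⟩ := tsum_enorm_fourier_unitCut_sq_le hφ N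
  set k : E d → ℝ≥0∞ := fun ζ => ENNReal.ofReal ((1 + ‖ζ‖ ^ 2) ^ N)⁻¹ ^ 2 with hk
  set K : E d → ℝ≥0∞ := fun ζ => ‖((80 * (1 + ‖ζ‖ ^ 2)) ^ (S / 2) : ℝ)‖ₑ ^ 2 * k ζ with hK
  have hkm : Measurable k := by fun_prop
  have hKm : Measurable K := by fun_prop
  refine ⟨A * ∫⁻ ζ, K ζ, ENNReal.mul_ne_top hA hN, fun s hs hsS f => ?_⟩
  set F : E d → ℂ := ((𝓕 f : L2 d) : E d → ℂ)
  have hFm : Measurable fun x => ‖F x‖ₑ ^ 2 := (Lp.stronglyMeasurable _).enorm.pow_const _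
  set W : E d → ℝ≥0∞ := fun η => sobolevWeight s ((2 * Real.pi) • η) with hW
  have hWm : Measurable W := (measurable_sobolevWeight s).comp (measurable_const_smul _)
  set c := ENNReal.ofReal |(2 * Real.pi)⁻¹ ^ d|⁻¹
  have hu : ∀ i, weightedSq (sobolevWeight s) (mulL2 (unitCut φ i) f) =
      c * ∫⁻ η, W η * ‖𝓕 (fun x => (unitCut φ i x : ℂ) * f x) η‖ₑ ^ 2 := by
    intro i
    rw [weightedSq_eq_fourier]
    congr 1
    refine lintegral_congr_ae ?_
    filter_upwards [fourier_toL2 (hφ.integrable_unitCut_mul i f)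
      (memLp_mul_of_bound (measurable_unitCut hφ i) (abs_unitCut_le hφ i) (Lp.memLp f))] with η hη
    rw [mulL2, hη]
  simp_rw [hu]
  rw [ENNReal.tsum_mul_left, ← lintegral_tsum fun i => by
      exact (hWm.mul ((continuous_fourier
        (hφ.integrable_unitCut_mul i f)).measurable.enorm.pow_const 2)).aemeasurable,
    weightedSq_eq_fourier]
  simp_rw [ENNReal.tsum_mul_left]
  calc c * ∫⁻ η, W η * ∑' i, ‖𝓕 (fun x => (unitCut φ i x : ℂ) * f x) η‖ₑ ^ 2
      ≤ c * ∫⁻ η, A * ∫⁻ ζ, K ζ * (W (ζ + η) * ‖F (ζ + η)‖ₑ ^ 2) := by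
        refine mul_le_mul_right (lintegral_mono fun η => ?_) _
        refine (mul_le_mul_right (hAf f η) _).trans ?_
        rw [mul_left_comm]
        gcongr
        rw [← lintegral_const_mul _ (by fun_prop)]
        refine lintegral_mono fun ζ => ?_
        calc _ ≤ (‖((80 * (1 + ‖ζ‖ ^ 2)) ^ (S / 2) : ℝ)‖ₑ ^ 2 * W (ζ + η)) *
              (k ζ * ‖F (ζ + η)‖ₑ ^ 2) := by
              gcongr
              exact sobolevWeight_le hs hsS ζ η
          _ = _ := by simp only [hK]; ring
    _ = c * (A * ∫⁻ ζ, K ζ * ∫⁻ η, W (ζ + η) * ‖F (ζ + η)‖ₑ ^ 2) := by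
        rw [lintegral_const_mul' _ _ hA, lintegral_lintegral_swap (by fun_prop)]
        congr 2
        refine lintegral_congr fun ζ => ?_
        rw [lintegral_const_mul _ (by fun_prop)]
    _ = _ := by
        -- By translation invariance the inner integral no longer depends on `ζ`: the weighted norm
        -- of `f` factors out and leaves `∫ K`.
        simp_rw [lintegral_add_left_eq_self (fun x => W x * ‖F x‖ₑ ^ 2)]
        rw [lintegral_mul_const _ hKm]
        ring

/-! ### Square sums over the frequency decompositions -/

theorem weightedSq_fourierMult (W : E d → ℝ≥0∞) {m : E d → ℝ} (hm : Measurable m)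
    (hB : ∀ x, |m x| ≤ 1) (f : L2 d) :
    weightedSq W (fourierMult m f) = ∫⁻ ξ, ‖m ξ‖ₑ ^ 2 * (W ξ * ‖hat f ξ‖ₑ ^ 2) := by
  rw [weightedSq_congr (hat_fourierMult hm hB f)]
  refine lintegral_congr fun ξ => ?_
  rw [enorm_mul, mul_pow, mul_left_comm, ← ofReal_norm, Complex.norm_real, ofReal_norm]

theorem tsum_weightedSq_fourierMult_le {ι : Type*} [Countable ι] {W : E d → ℝ≥0∞}
    (hW : Measurable W) {m : ι → E d → ℝ} (hm : ∀ i, Measurable (m i))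
    (hB : ∀ i x, |m i x| ≤ 1) {K : ℝ≥0∞} (hK : ∀ x, ∑' i, ‖m i x‖ₑ ^ 2 ≤ K) (f : L2 d) :
    ∑' i, weightedSq W (fourierMult (m i) f) ≤ K * weightedSq W f := by
  have hf : Measurable fun ξ => ‖hat f ξ‖ₑ ^ 2 := (stronglyMeasurable_hat f).enorm.pow_const _
  simp_rw [fun i => weightedSq_fourierMult W (hm i) (hB i) f]
  rw [← lintegral_tsum fun i => by
      exact (((hm i).enorm.pow_const 2).mul (hW.mul hf)).aemeasurable,
    weightedSq, ← lintegral_const_mul _ (by fun_prop)]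
  refine lintegral_mono fun ξ => ?_
  rw [ENNReal.tsum_mul_right]
  exact mul_le_mul_left (hK ξ) _

theorem tsum_weightedSq_unitProj_le {φ : E d → ℝ} (hφ : IsUnitBump φ) {W : E d → ℝ≥0∞}
    (hW : Measurable W) (f : L2 d) : ∑' j, weightedSq W (unitProj φ j f) ≤ weightedSq W f :=
  (tsum_weightedSq_fourierMult_le hW (measurable_unitCut hφ) (abs_unitCut_le hφ)
    hφ.tsum_enorm_unitCut_sq_le f).trans_eq (one_mul _)

/-- Both bumps equal one for `|ξ| ≤ M/2` and both vanish for `|ξ| > 2M`. So only the scales within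
one dyadic step of `2^{m₀} ≤ |ξ| < 2^{m₀+1}` contribute, each by at most one; at the origin all cuts
vanish. -/
theorem tsum_enorm_dyadicCut_sq_le {χ : E d → ℝ} (hχ : IsDyadicBump χ) (ξ : E d) :
    ∑' m, ‖dyadicCut χ m ξ‖ₑ ^ 2 ≤ 3 := by
  set m₀ := Int.log 2 ‖ξ‖ with hm₀
  have hout : ∀ m ∉ Finset.Icc (m₀ - 1) (m₀ + 1), ‖dyadicCut χ m ξ‖ₑ ^ 2 = 0 := by
    intro m hm
    have hz : dyadicCut χ m ξ = 0 := by
      rcases eq_or_ne ξ 0 with rfl | hξ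
      · simp [dyadicCut]
      have hp : 0 < ‖ξ‖ := norm_pos_iff.2 hξ
      have h2 : (0 : ℝ) < 2 ^ m := by positivity
      have n1 : ‖((2 : ℝ) ^ m)⁻¹ • ξ‖ = ‖ξ‖ / 2 ^ m := by
        rw [norm_smul, Real.norm_of_nonneg (by positivity)]; field_simp
      have n2 : ‖(2 / (2 : ℝ) ^ m) • ξ‖ = 2 * ‖ξ‖ / 2 ^ m := by
        rw [norm_smul, Real.norm_of_nonneg (by positivity)]; field_simp
      rw [Finset.mem_Icc, not_and_or, not_le, not_le] at hm
      unfold dyadicCut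
      rcases hm with hm | hm
      · have h3 : (2 : ℝ) ^ (m + 2) ≤ 2 ^ m₀ := zpow_le_zpow_right₀ (by norm_num) (by omega)
        have h4 : (2 : ℝ) ^ m₀ ≤ ‖ξ‖ := by exact_mod_cast Int.zpow_log_le_self (by norm_num) hp
        rw [zpow_add₀ (by norm_num)] at h3
        norm_num at h3
        rw [hχ.eq_zero _ (by rw [n1, lt_div_iff₀ h2]; linarith),
          hχ.eq_zero _ (by rw [n2, lt_div_iff₀ h2]; linarith), sub_zero]
      · have h3 : (2 : ℝ) ^ (m₀ + 1 + 1) ≤ 2 ^ m := zpow_le_zpow_right₀ (by norm_num) (by omega)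
        have h4 : ‖ξ‖ < (2 : ℝ) ^ (m₀ + 1) := by
          exact_mod_cast Int.lt_zpow_succ_log_self (b := 2) (by norm_num) ‖ξ‖
        rw [zpow_add₀ (by norm_num)] at h3
        norm_num at h3
        rw [hχ.eq_one _ (by rw [n1, div_le_one h2]; linarith),
          hχ.eq_one _ (by rw [n2, div_le_one h2]; linarith), sub_self]
    simp [hz]
  rw [tsum_eq_sum hout]
  refine (Finset.sum_le_card_nsmul _ _ (1 : ℝ≥0∞) fun m _ => ?_).trans ?_
  · refine pow_le_one' ?_ 2
    rw [← ofReal_norm, ENNReal.ofReal_le_one]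
    exact abs_dyadicCut_le hχ m ξ
  · rw [Int.card_Icc, show (m₀ + 1 + 1 - (m₀ - 1)).toNat = 3 by omega]
    norm_num

theorem tsum_weightedSq_dyadicProj_le {χ : E d → ℝ} (hχ : IsDyadicBump χ) {W : E d → ℝ≥0∞}
    (hW : Measurable W) (f : L2 d) :
    ∑' m, weightedSq W (dyadicProj χ m f) ≤ 3 * weightedSq W f :=
  tsum_weightedSq_fourierMult_le hW (measurable_dyadicCut hχ) (abs_dyadicCut_le hχ)
    (tsum_enorm_dyadicCut_sq_le hχ) f

theorem weightedSq_dilate (W : E d → ℝ≥0∞) {a : ℝ} (ha : a ≠ 0) (f : L2 d) :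
    weightedSq W (dilate a f) =
      ENNReal.ofReal |a ^ d|⁻¹ * weightedSq (fun ξ => W (a • ξ)) f := by
  have hpos : 0 < |a ^ d| := by positivity
  rw [weightedSq_congr (hat_dilate ha f)]
  have h := lintegral_comp_smul (inv_ne_zero ha) fun ξ => W (a • ξ) * ‖hat f ξ‖ₑ ^ 2
  simp only [smul_smul, mul_inv_cancel₀ ha, one_smul] at h
  have h2 : ∀ ξ, W ξ * ‖(|a ^ d|⁻¹ : ℝ) • hat f (a⁻¹ • ξ)‖ₑ ^ 2 =
      ENNReal.ofReal |a ^ d|⁻¹ ^ 2 * (W ξ * ‖hat f (a⁻¹ • ξ)‖ₑ ^ 2) := by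
    intro ξ
    rw [enorm_smul, mul_pow, Real.enorm_of_nonneg (by positivity)]
    ring
  simp_rw [h2]
  rw [lintegral_const_mul' _ _ (by finiteness), h, inv_pow, abs_inv, inv_inv, weightedSq,
    ← mul_assoc, pow_two, mul_assoc (ENNReal.ofReal _), ← ENNReal.ofReal_mul (by positivity),
    inv_mul_cancel₀ hpos.ne', ENNReal.ofReal_one, mul_one]

/-! ### The angular decomposition -/

theorem lintegral_polar (hd : 0 < d) (G : E d → ℝ≥0∞) :
    ∫⁻ ξ, G ξ = ∫⁻ z : Sph d × Set.Ioi (0 : ℝ), G ((z.2 : ℝ) • (z.1 : E d))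
      ∂((surf d).prod (Measure.volumeIoiPow (Module.finrank ℝ (E d) - 1))) := by
  have : Nontrivial (E d) := by
    have : Nonempty (Fin d) := ⟨⟨0, hd⟩⟩
    infer_instance
  have hΦ := (volume : Measure (E d)).measurePreserving_homeomorphUnitSphereProd
  have h1 : ∫⁻ ξ, G ξ = ∫⁻ z : ({0}ᶜ : Set (E d)), G z
      ∂(Measure.comap (↑) (volume : Measure (E d))) := by
    rw [← (MeasurableEmbedding.subtype_coe (measurableSet_singleton (0 : E d)).compl).lintegral_map,
      map_comap_subtype_coe (measurableSet_singleton (0 : E d)).compl,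
      MeasureTheory.restrict_compl_singleton]
  rw [h1, ← (hΦ.symm (homeomorphUnitSphereProd (E d)).toMeasurableEquiv).lintegral_comp_emb
    (MeasurableEquiv.measurableEmbedding _)]
  rfl

theorem polarFun_smul (c : ℝ → ℂ) (Y : Sph d → ℂ) {ρ : ℝ} (hρ : 0 < ρ) (θ : Sph d) :
    polarFun c Y (ρ • (θ : E d)) = c ρ * Y θ := by
  have hθ : ‖(θ : E d)‖ = 1 := by simp
  have h0 : ρ • (θ : E d) ≠ 0 := smul_ne_zero hρ.ne' (by rw [← norm_ne_zero_iff, hθ]; norm_num)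
  have hn : ‖ρ • (θ : E d)‖ = ρ := by rw [norm_smul, hθ, mul_one, Real.norm_of_nonneg hρ.le]
  rw [polarFun, dif_neg h0]
  congr 1
  · rw [hn]
  · congr 1
    refine Subtype.ext ?_
    simp only [hn, smul_smul, inv_mul_cancel₀ hρ.ne', one_smul]

theorem stronglyMeasurable_angCoeff {u : E d → ℂ} (hu : StronglyMeasurable u) {Y : Sph d → ℂ}
    (hY : Continuous Y) : StronglyMeasurable fun ρ : Set.Ioi (0 : ℝ) => angCoeff u Y ρ := by
  have hw : StronglyMeasurable (fun z : Set.Ioi (0 : ℝ) × Sph d =>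
      u ((z.1 : ℝ) • (z.2 : E d)) * conj (Y z.2)) := by
    refine (hu.comp_measurable (by fun_prop)).mul ?_
    exact (Complex.continuous_conj.comp (hY.comp continuous_snd)).stronglyMeasurable
  exact hw.integral_prod_right

/-- The Bessel inequality for spherical harmonics. -/
theorem IsHarmBasis.tsum_enorm_sq_le {b : (k : ℕ) → Fin (numHarm d k) → Sph d → ℂ}
    (hb : IsHarmBasis b) {v : Sph d → ℂ} (hv : AEStronglyMeasurable v (surf d)) :
    ∑' n : Σ k, Fin (numHarm d k), ‖∫ θ, v θ * conj (b n.1 n.2 θ) ∂(surf d)‖ₑ ^ 2 ≤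
      ∫⁻ θ, ‖v θ‖ₑ ^ 2 ∂(surf d) := by
  rw [lintegral_enorm_sq]
  -- The restriction of an `L²` function to a sphere is square-integrable only for almost every
  -- radius. Allowing an infinite right side lets the inequality be used at all radii.
  by_cases hv2 : eLpNorm v 2 (surf d) = ∞
  · simp [hv2]
  have hvL : MemLp v 2 (surf d) := ⟨hv, lt_top_iff_ne_top.2 hv2⟩
  have hbL : ∀ n : Σ k, Fin (numHarm d k), MemLp (b n.1 n.2) 2 (surf d) := fun n => by
    have hc := continuous_of_mem_sphHarm (hb.mem n.1 n.2)
    obtain ⟨B, hB⟩ := isCompact_univ.exists_bound_of_continuousOn hc.continuousOn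
    exact MemLp.of_bound hc.aestronglyMeasurable B (.of_forall fun θ => hB θ trivial)
  have hin : ∀ (n : Σ k, Fin (numHarm d k)) {w : Sph d → ℂ} (hw : MemLp w 2 (surf d)),
      inner ℂ ((hbL n).toLp _) (hw.toLp w) = ∫ θ, w θ * conj (b n.1 n.2 θ) ∂(surf d) := by
    intro n w hw
    rw [L2.inner_def]
    refine integral_congr_ae ?_
    filter_upwards [(hbL n).coeFn_toLp, hw.coeFn_toLp] with θ h1 h2
    rw [h1, h2, RCLike.inner_apply]
  have ho : Orthonormal ℂ fun n => (hbL n).toLp _ := by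
    classical
    refine orthonormal_iff_ite.2 fun n n' => ?_
    rw [hin n (hbL n')]
    split_ifs with h
    · subst h; exact hb.norm_one _ _
    · exact hb.orthogonal _ _ _ _ (Ne.symm h)
  rw [ENNReal.tsum_eq_iSup_sum]
  refine iSup_le fun t => ?_
  have h := ho.sum_inner_products_le (x := hvL.toLp v) (s := t)
  simp_rw [fun n => hin n hvL] at h
  have h2 := ENNReal.ofReal_le_ofReal h
  rw [ENNReal.ofReal_sum_of_nonneg (fun _ _ => by positivity), ENNReal.ofReal_pow (by positivity),
    ofReal_norm, Lp.enorm_def, eLpNorm_congr_ae hvL.coeFn_toLp] at h2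
  simpa only [ENNReal.ofReal_pow (norm_nonneg _), ofReal_norm] using h2

/-- In polar coordinates a radial weight leaves a product of a function of `ρ` and `|Y(θ)|²`, and
the latter integrates to one. -/
theorem weightedSq_angPiece (hd : 0 < d) {V : ℝ → ℝ≥0∞} (hV : Measurable V) {Y : Sph d → ℂ}
    (hY : Continuous Y) (hY1 : ∫⁻ θ, ‖Y θ‖ₑ ^ 2 ∂(surf d) = 1) (g : L2 d) :
    weightedSq (fun ξ => V ‖ξ‖) (angPiece Y g) =
      ∫⁻ ρ : Set.Ioi (0 : ℝ), V ρ * ‖angCoeff (hat g) Y ρ‖ₑ ^ 2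
        ∂(Measure.volumeIoiPow (Module.finrank ℝ (E d) - 1)) := by
  have hc := stronglyMeasurable_angCoeff (stronglyMeasurable_hat g) hY
  have hcm : Measurable fun ρ : Set.Ioi (0 : ℝ) => V ρ * ‖angCoeff (hat g) Y ρ‖ₑ ^ 2 :=
    (hV.comp measurable_subtype_coe).mul (hc.enorm.pow_const 2)
  have hYm : Measurable fun θ => ‖Y θ‖ₑ ^ 2 := (hY.measurable.enorm).pow_const 2
  rw [weightedSq_congr (hat_angPiece hY g), lintegral_polar hd]
  have h1 : ∀ z : Sph d × Set.Ioi (0 : ℝ), V ‖(z.2 : ℝ) • (z.1 : E d)‖ *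
      ‖polarFun (angCoeff (hat g) Y) Y ((z.2 : ℝ) • (z.1 : E d))‖ₑ ^ 2 =
      (V z.2 * ‖angCoeff (hat g) Y z.2‖ₑ ^ 2) * ‖Y z.1‖ₑ ^ 2 := by
    intro z
    have hz : ‖(z.1 : E d)‖ = 1 := by simp
    rw [polarFun_smul _ _ z.2.2, norm_smul, hz, mul_one, Real.norm_of_nonneg (le_of_lt z.2.2),
      enorm_mul, mul_pow, mul_assoc]
  simp_rw [h1]
  rw [lintegral_prod_symm _ (by
    exact ((hcm.comp measurable_snd).mul (hYm.comp measurable_fst)).aemeasurable)]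
  refine lintegral_congr fun ρ => ?_
  exact (lintegral_const_mul (V ρ * ‖angCoeff (hat g) Y ρ‖ₑ ^ 2) hYm).trans (by rw [hY1, mul_one])

/-- Bessel's inequality on each sphere, integrated over the radius. The weight must be radial to be
constant on spheres. -/
theorem tsum_weightedSq_angPiece_le (hd : 0 < d) {V : ℝ → ℝ≥0∞} (hV : Measurable V)
    {b : (k : ℕ) → Fin (numHarm d k) → Sph d → ℂ} (hb : IsHarmBasis b) (g : L2 d) :
    ∑' n : Σ k, Fin (numHarm d k), weightedSq (fun ξ => V ‖ξ‖) (angPiece (b n.1 n.2) g) ≤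
      weightedSq (fun ξ => V ‖ξ‖) g := by
  have hY : ∀ n : Σ k, Fin (numHarm d k), Continuous (b n.1 n.2) :=
    fun n => continuous_of_mem_sphHarm (hb.mem _ _)
  have hY1 : ∀ n : Σ k, Fin (numHarm d k), ∫⁻ θ, ‖b n.1 n.2 θ‖ₑ ^ 2 ∂(surf d) = 1 := by
    intro n
    have h := hb.norm_one n.1 n.2
    have h2 : ∫ θ, ‖b n.1 n.2 θ‖ ^ 2 ∂(surf d) = 1 := by
      rw [← Complex.ofReal_inj, ← integral_complex_ofReal, ← Complex.ofReal_one.symm, ← h]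
      simp [Complex.mul_conj, Complex.normSq_eq_norm_sq]
    have hi : Integrable (fun θ => ‖b n.1 n.2 θ‖ ^ 2) (surf d) :=
      Continuous.integrable_of_hasCompactSupport (by have := hY n; fun_prop) (.of_compactSpace _)
    have h3 := ENNReal.ofReal_one
    rw [← h2, ofReal_integral_eq_lintegral_ofReal hi (.of_forall fun _ => by positivity)] at h3
    simpa only [ENNReal.ofReal_pow (norm_nonneg _), ofReal_norm] using h3
  have hu := stronglyMeasurable_hat g
  simp_rw [fun n => weightedSq_angPiece hd hV (hY n) (hY1 n) g]
  rw [← lintegral_tsum fun n => by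
    exact ((hV.comp measurable_subtype_coe).mul
      ((stronglyMeasurable_angCoeff hu (hY n)).enorm.pow_const 2)).aemeasurable]
  simp_rw [ENNReal.tsum_mul_left]
  rw [weightedSq, lintegral_polar hd, lintegral_prod_symm _ (by
    have h1 : Measurable fun z : Sph d × Set.Ioi (0 : ℝ) => (z.2 : ℝ) • (z.1 : E d) := by fun_prop
    exact ((hV.comp (measurable_norm.comp h1)).mul
      ((hu.comp_measurable h1).enorm.pow_const 2)).aemeasurable)]
  refine lintegral_mono fun ρ => ?_
  have hρ : (0 : ℝ) < ρ := ρ.2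
  have hm : Measurable fun θ : Sph d => (ρ : ℝ) • (θ : E d) := by fun_prop
  have h1 : ∀ θ : Sph d, V ‖(ρ : ℝ) • (θ : E d)‖ * ‖hat g ((ρ : ℝ) • (θ : E d))‖ₑ ^ 2 =
      V ρ * ‖hat g ((ρ : ℝ) • (θ : E d))‖ₑ ^ 2 := by
    intro θ
    have hz : ‖(θ : E d)‖ = 1 := by simp
    rw [norm_smul, hz, mul_one, Real.norm_of_nonneg hρ.le]
  simp_rw [h1]
  rw [lintegral_const_mul _ (by exact ((hu.comp_measurable hm).enorm.pow_const 2))]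
  exact mul_le_mul_right (hb.tsum_enorm_sq_le (hu.comp_measurable hm).aestronglyMeasurable) _

/-- Dilation replaces `V` by `V(M ·)`, which is again radial, so the angular estimate applies at
every scale; the Jacobians of the two dilations cancel. -/
theorem tsum_weightedSq_angularPiece_le (hd : 0 < d) {V : ℝ → ℝ≥0∞} (hV : Measurable V)
    {b : (k : ℕ) → Fin (numHarm d k) → Sph d → ℂ} (hb : IsHarmBasis b) (φ χ : E d → ℝ)
    (f : L2 d) (m : ℤ) (i : Fin d → ℤ) :
    ∑' n : Σ k, Fin (numHarm d k),
        weightedSq (fun ξ => V ‖ξ‖) (angularPiece φ χ (b n.1 n.2) f m i) ≤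
      weightedSq (fun ξ => V ‖ξ‖) (dyadicProj χ m (mulL2 (unitCut φ i) f)) := by
  set M : ℝ := 2 ^ m with hM
  have hM0 : 0 < M := by positivity
  have hVM : (fun ξ : E d => V ‖M • ξ‖) = fun ξ => V (M * ‖ξ‖) := by
    funext ξ; rw [norm_smul, Real.norm_of_nonneg hM0.le]
  simp only [angularPiece, ← hM]
  simp_rw [fun n : Σ k, Fin (numHarm d k) => weightedSq_dilate (fun ξ => V ‖ξ‖) hM0.ne'
    (angPiece (b n.1 n.2) (rescaledPiece φ χ f m i)), hVM]
  rw [ENNReal.tsum_mul_left]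
  refine (mul_le_mul_right (tsum_weightedSq_angPiece_le hd (V := fun r => V (M * r))
    (hV.comp (measurable_const_mul M)) hb _) _).trans (le_of_eq ?_)
  rw [rescaledPiece, ← hM, weightedSq_dilate _ (inv_ne_zero hM0.ne'), ← mul_assoc,
    ← ENNReal.ofReal_mul (by positivity), inv_pow, abs_inv, inv_inv,
    inv_mul_cancel₀ (by positivity), ENNReal.ofReal_one, one_mul]
  congr 1
  funext ξ
  rw [norm_smul, Real.norm_of_nonneg (by positivity), ← mul_assoc, mul_inv_cancel₀ hM0.ne', one_mul]

/-! ### Summation over all indices -/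

/-- The indices as a product, with `j` last. -/
def idxEquiv (d : ℕ) :
    Idx d ≃ (((Fin d → ℤ) × ℤ) × (Σ k, Fin (numHarm d k))) × (Fin d → ℤ) where
  toFun n := (((n.i, n.m), ⟨n.k, n.l⟩), n.j)
  invFun p := ⟨p.1.1.2, p.1.1.1, p.2, p.1.2.1, p.1.2.2⟩
  left_inv _ := rfl
  right_inv _ := rfl

instance : Countable (Idx d) := (idxEquiv d).countable_iff.2 inferInstance

theorem tsum_idx (G : Idx d → ℝ≥0∞) : ∑' n, G n =
    ∑' (i : Fin d → ℤ) (m : ℤ) (n : Σ k, Fin (numHarm d k)) (j : Fin d → ℤ),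
      G ⟨m, i, j, n.1, n.2⟩ := by
  rw [← (idxEquiv d).symm.tsum_eq, ENNReal.summable.tsum_prod' fun _ => ENNReal.summable,
    ENNReal.summable.tsum_prod' fun _ => ENNReal.summable,
    ENNReal.summable.tsum_prod' fun _ => ENNReal.summable]
  rfl

theorem piece_mk (φ χ : E d → ℝ) (b : (k : ℕ) → Fin (numHarm d k) → Sph d → ℂ) (f : L2 d) (m : ℤ)
    (i j : Fin d → ℤ) (k : ℕ) (l : Fin (numHarm d k)) :
    piece φ χ b f ⟨m, i, j, k, l⟩ = unitProj φ j (angularPiece φ χ (b k l) f m i) := by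
  rw [piece]

/-- The indices are removed from the inside out: `j` and `(k, l)` cost a factor one, `M` a factor
three. -/
theorem tsum_weightedSq_piece_le (hd : 0 < d) {φ χ : E d → ℝ} (hφ : IsUnitBump φ)
    (hχ : IsDyadicBump χ) {b : (k : ℕ) → Fin (numHarm d k) → Sph d → ℂ} (hb : IsHarmBasis b)
    {V : ℝ → ℝ≥0∞} (hV : Measurable V) (f : L2 d) :
    ∑' n, weightedSq (fun ξ => V ‖ξ‖) (piece φ χ b f n) ≤
      3 * ∑' i, weightedSq (fun ξ => V ‖ξ‖) (mulL2 (unitCut φ i) f) := by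
  have hW : Measurable fun ξ : E d => V ‖ξ‖ := hV.comp measurable_norm
  have h1 : ∀ i m (n : Σ k, Fin (numHarm d k)),
      ∑' j, weightedSq (fun ξ => V ‖ξ‖) (piece φ χ b f ⟨m, i, j, n.1, n.2⟩) ≤
        weightedSq (fun ξ => V ‖ξ‖) (angularPiece φ χ (b n.1 n.2) f m i) :=
    fun i m n => by
      simp only [piece_mk]
      exact tsum_weightedSq_unitProj_le hφ hW _
  have h2 : ∀ i, ∑' (m : ℤ) (n : Σ k, Fin (numHarm d k)),
      weightedSq (fun ξ => V ‖ξ‖) (angularPiece φ χ (b n.1 n.2) f m i) ≤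
        3 * weightedSq (fun ξ => V ‖ξ‖) (mulL2 (unitCut φ i) f) := fun i =>
    (ENNReal.tsum_le_tsum fun m => tsum_weightedSq_angularPiece_le hd hV hb φ χ f m i).trans
      (tsum_weightedSq_dyadicProj_le hχ hW _)
  rw [tsum_idx, ← ENNReal.tsum_mul_left]
  exact ENNReal.tsum_le_tsum fun i => le_trans (ENNReal.tsum_le_tsum fun m =>
    ENNReal.tsum_le_tsum fun n => h1 i m n) (h2 i)

/-! ### Moments of sub-Gaussian sums -/

section Moments

variable {Ω : Type*} [MeasurableSpace Ω] {P : Measure Ω}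

/-- Raise `t ≤ e^t` with `t = r|y|/q` to the power `q`, then bound `e^{r|y|}` by the sum of both
signs. -/
theorem abs_rpow_le_exp {q r : ℝ} (hq : 0 < q) (hr : 0 < r) (y : ℝ) :
    |y| ^ q ≤ (q / r) ^ q * (Real.exp (r * y) + Real.exp (-r * y)) := by
  have h1 : r / q * |y| ≤ Real.exp (r / q * |y|) := by
    linarith [Real.add_one_le_exp (r / q * |y|)]
  have h2 : |y| ^ q ≤ (q / r) ^ q * Real.exp (r * |y|) := by
    have h3 : |y| ≤ q / r * Real.exp (r / q * |y|) := by
      calc |y| = q / r * (r / q * |y|) := by field_simp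
        _ ≤ _ := by gcongr
    calc |y| ^ q ≤ (q / r * Real.exp (r / q * |y|)) ^ q := by gcongr
      _ = _ := by
        rw [Real.mul_rpow (by positivity) (by positivity), ← Real.exp_mul]
        congr 2
        field_simp
  refine h2.trans (mul_le_mul_of_nonneg_left ?_ (by positivity))
  rcases abs_cases y with ⟨h, -⟩ | ⟨h, -⟩ <;> rw [h]
  · linarith [Real.exp_pos (-r * y)]
  · rw [mul_neg, ← neg_mul]; linarith [Real.exp_pos (r * y)]

theorem lintegral_enorm_rpow_le_of_subgaussian {Y : Ω → ℝ} {v : ℝ≥0} (hY : HasSubgaussianMGF Y v P)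
    {c σ q : ℝ} (hσ : 0 < σ) (hv : v ≤ 2 * c * σ ^ 2) (hq : 1 ≤ q) :
    ∫⁻ ω, ‖Y ω‖ₑ ^ q ∂P ≤ ENNReal.ofReal (2 * Real.exp c * √q * σ) ^ q := by
  have hq0 : 0 < q := by linarith
  -- This choice balances the two factors: `(q/r)^q` becomes `(√q σ)^q`, and the exponential moment
  -- is at most `e^{cq}`, again a `q`-th power.
  set r := √q / σ with hr
  have hr0 : 0 < r := by positivity
  have hqr : q / r = √q * σ := by
    rw [hr]; field_simp; rw [Real.sq_sqrt hq0.le]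
  have hexp : ∀ t : ℝ, t ^ 2 = r ^ 2 → ∫ ω, Real.exp (t * Y ω) ∂P ≤ Real.exp (c * q) := by
    intro t ht
    refine (hY.mgf_le t).trans (Real.exp_le_exp.2 ?_)
    have h1 : r ^ 2 * σ ^ 2 = q := by
      rw [hr, div_pow, Real.sq_sqrt hq0.le]; field_simp
    rw [ht]
    calc (v : ℝ) * r ^ 2 / 2 ≤ 2 * c * σ ^ 2 * r ^ 2 / 2 := by gcongr
      _ = c * (r ^ 2 * σ ^ 2) := by ring
      _ = c * q := by rw [h1]
  have hi : Integrable (fun ω => (q / r) ^ q * (Real.exp (r * Y ω) + Real.exp (-r * Y ω))) P :=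
    ((hY.integrable_exp_mul r).add (hY.integrable_exp_mul (-r))).const_mul _
  calc ∫⁻ ω, ‖Y ω‖ₑ ^ q ∂P
      ≤ ∫⁻ ω, ENNReal.ofReal ((q / r) ^ q * (Real.exp (r * Y ω) + Real.exp (-r * Y ω))) ∂P := by
        refine lintegral_mono fun ω => ?_
        rw [← ofReal_norm, Real.norm_eq_abs, ENNReal.ofReal_rpow_of_nonneg (abs_nonneg _) hq0.le]
        exact ENNReal.ofReal_le_ofReal (abs_rpow_le_exp hq0 hr0 _)
    _ = ENNReal.ofReal (∫ ω, (q / r) ^ q * (Real.exp (r * Y ω) + Real.exp (-r * Y ω)) ∂P) :=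
        (ofReal_integral_eq_lintegral_ofReal hi (.of_forall fun ω => by positivity)).symm
    _ ≤ ENNReal.ofReal ((2 * Real.exp c * √q * σ) ^ q) := by
        refine ENNReal.ofReal_le_ofReal ?_
        rw [integral_const_mul, integral_add (hY.integrable_exp_mul r)
          (hY.integrable_exp_mul (-r)), hqr, show 2 * Real.exp c * √q * σ =
            (√q * σ) * (2 * Real.exp c) by ring,
          Real.mul_rpow (x := √q * σ) (by positivity) (by positivity),
          Real.mul_rpow (x := 2) (y := Real.exp c) (by positivity) (by positivity), ← Real.exp_mul]
        refine mul_le_mul_of_nonneg_left ?_ (by positivity)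
        have h2 : (2 : ℝ) ≤ 2 ^ q := by
          simpa using Real.rpow_le_rpow_of_exponent_le (by norm_num : (1 : ℝ) ≤ 2) hq
        calc _ ≤ Real.exp (c * q) + Real.exp (c * q) :=
              add_le_add (hexp r rfl) (hexp (-r) (neg_sq r))
          _ = 2 * Real.exp (c * q) := by ring
          _ ≤ _ := by gcongr
    _ = _ := (ENNReal.ofReal_rpow_of_nonneg (by positivity) hq0.le).symm

variable {ι : Type*} {c : ℝ} {X : ι → Ω → ℝ}

/-- `HasSubgaussianMGF` is normalised by `e^{vt²/2}`, which turns `c` into `v = 2c`. -/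
theorem IsRandomFamily.hasSubgaussianMGF (hX : IsRandomFamily P c X) (hc : 0 ≤ c) (n : ι) :
    HasSubgaussianMGF (X n) (2 * c).toNNReal P where
  integrable_exp_mul := hX.integrable_exp n
  mgf_le t := by
    refine (hX.exp_bound n t).trans (le_of_eq ?_)
    rw [Real.coe_toNNReal _ (by positivity)]
    congr 1; ring

theorem IsRandomFamily.hasSubgaussianMGF_sum (hX : IsRandomFamily P c X) (hc : 0 ≤ c)
    (t : Finset ι) (x : ι → ℝ) :
    HasSubgaussianMGF (fun ω => ∑ n ∈ t, x n * X n ω)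
      (∑ n ∈ t, (x n ^ 2).toNNReal * (2 * c).toNNReal) P :=
  HasSubgaussianMGF.sum_of_iIndepFun (X := fun n ω => x n * X n ω)
    (hX.indep.comp (fun n y => x n * y) fun n => measurable_const_mul (x n))
    fun n _ => by
      have h := (hX.hasSubgaussianMGF hc n).const_mul (x n)
      rwa [Real.toNNReal_of_nonneg (sq_nonneg (x n))]

theorem IsRandomFamily.lintegral_enorm_real_sum_rpow_le (hX : IsRandomFamily P c X) (hc : 0 ≤ c)
    (t : Finset ι) (x : ι → ℝ) {σ q : ℝ} (hσ : 0 < σ) (hxσ : ∑ n ∈ t, x n ^ 2 ≤ σ ^ 2)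
    (hq : 1 ≤ q) :
    ∫⁻ ω, ‖∑ n ∈ t, x n * X n ω‖ₑ ^ q ∂P ≤ ENNReal.ofReal (2 * Real.exp c * √q * σ) ^ q := by
  refine lintegral_enorm_rpow_le_of_subgaussian (hX.hasSubgaussianMGF_sum hc t x) hσ ?_ hq
  simp only [NNReal.coe_sum, NNReal.coe_mul, Real.coe_toNNReal _ (sq_nonneg _),
    Real.coe_toNNReal (2 * c) (by positivity)]
  rw [← Finset.sum_mul, mul_comm]
  exact mul_le_mul_of_nonneg_left hxσ (by positivity)

/-- The Khintchine inequality for independent sub-Gaussian variables and complex coefficients. -/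
theorem IsRandomFamily.lintegral_enorm_sum_rpow_le (hX : IsRandomFamily P c X) (hc : 0 ≤ c)
    (t : Finset ι) (z : ι → ℂ) {q : ℝ} (hq : 1 ≤ q) :
    ∫⁻ ω, ‖∑ n ∈ t, X n ω • z n‖ₑ ^ q ∂P ≤
      ENNReal.ofReal (4 * Real.exp c * √q) ^ q * (∑ n ∈ t, ‖z n‖ₑ ^ 2) ^ (q / 2) := by
  have hq0 : 0 < q := by linarith
  set s := ∑ n ∈ t, ‖z n‖ ^ 2 with hs
  have hs' : ∑ n ∈ t, ‖z n‖ₑ ^ 2 = ENNReal.ofReal s := by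
    rw [hs, ENNReal.ofReal_sum_of_nonneg fun _ _ => by positivity]
    simp only [ENNReal.ofReal_pow (norm_nonneg _), ofReal_norm]
  have hs0 : 0 ≤ s := Finset.sum_nonneg fun _ _ => by positivity
  -- The real estimate needs `σ > 0`, so vanishing coefficients are treated apart. Otherwise `σ =
  -- √s` serves for both real and imaginary parts.
  rcases hs0.eq_or_lt with h0 | hpos
  · have hz : ∀ n ∈ t, z n = 0 := fun n hn => by
      have := (Finset.sum_eq_zero_iff_of_nonneg fun _ _ => by positivity).1 h0.symm n hn
      simpa using this
    have : ∀ ω, ∑ n ∈ t, X n ω • z n = 0 := fun ω =>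
      Finset.sum_eq_zero fun n hn => by rw [hz n hn, smul_zero]
    simp only [this]
    simp [hq0]
  have hσ : 0 < √s := Real.sqrt_pos.2 hpos
  have hσ2 : √s ^ 2 = s := Real.sq_sqrt hs0
  have hre : ∑ n ∈ t, (z n).re ^ 2 ≤ √s ^ 2 := by
    rw [hσ2]
    exact Finset.sum_le_sum fun n _ => by
      rw [← sq_abs]
      exact pow_le_pow_left₀ (abs_nonneg _) (Complex.abs_re_le_norm _) 2
  have him : ∑ n ∈ t, (z n).im ^ 2 ≤ √s ^ 2 := by
    rw [hσ2]
    exact Finset.sum_le_sum fun n _ => by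
      rw [← sq_abs]
      exact pow_le_pow_left₀ (abs_nonneg _) (Complex.abs_im_le_norm _) 2
  have h1 := hX.lintegral_enorm_real_sum_rpow_le hc t _ hσ hre hq
  have h2 := hX.lintegral_enorm_real_sum_rpow_le hc t _ hσ him hq
  set B := ENNReal.ofReal (2 * Real.exp c * √q * √s)
  have hm : ∀ x : ι → ℝ, Measurable fun ω => ‖∑ n ∈ t, x n * X n ω‖ₑ ^ q := fun x => by
    have := hX.measurable
    fun_prop
  calc ∫⁻ ω, ‖∑ n ∈ t, X n ω • z n‖ₑ ^ q ∂P
      ≤ ∫⁻ ω, 2 ^ (q - 1) * (‖∑ n ∈ t, (z n).re * X n ω‖ₑ ^ q +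
          ‖∑ n ∈ t, (z n).im * X n ω‖ₑ ^ q) ∂P := by
        refine lintegral_mono fun ω => ?_
        refine le_trans ?_ (ENNReal.rpow_add_le_mul_rpow_add_rpow _ _ hq)
        gcongr
        have e : ∑ n ∈ t, X n ω • z n = ((∑ n ∈ t, (z n).re * X n ω : ℝ) : ℂ) +
            ((∑ n ∈ t, (z n).im * X n ω : ℝ) : ℂ) * Complex.I := by
          apply Complex.ext <;> simp [mul_comm]
        rw [e]
        refine (enorm_add_le _ _).trans (le_of_eq ?_)
        simp only [← ofReal_norm, norm_mul, Complex.norm_real, Complex.norm_I, mul_one]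
    _ ≤ 2 ^ (q - 1) * (B ^ q + B ^ q) := by
        rw [lintegral_const_mul' _ _ (by finiteness), lintegral_add_left (hm _)]
        gcongr
    _ = (2 * B) ^ q := by
        rw [← two_mul, ← mul_assoc, ENNReal.mul_rpow_of_nonneg _ _ hq0.le]
        congr 1
        nth_rw 2 [← ENNReal.rpow_one 2]
        rw [← ENNReal.rpow_add _ _ (by norm_num) (by norm_num), sub_add_cancel]
    _ = _ := by
        have e : (2 : ℝ≥0∞) * B = ENNReal.ofReal (4 * Real.exp c * √q) * ENNReal.ofReal √s := by
          rw [← ENNReal.ofReal_mul (by positivity), ← ENNReal.ofReal_ofNat,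
            ← ENNReal.ofReal_mul (by positivity)]
          congr 1; ring
        rw [e, ENNReal.mul_rpow_of_nonneg _ _ hq0.le, hs']
        congr 1
        rw [ENNReal.ofReal_rpow_of_nonneg hσ.le hq0.le, ENNReal.ofReal_rpow_of_nonneg hs0
          (by positivity), Real.sqrt_eq_rpow, ← Real.rpow_mul hs0]
        congr 2; ring

/-- A form of the Minkowski integral inequality. -/
theorem lintegral_lintegral_rpow_le {α : Type*} [MeasurableSpace α] {μ : Measure α} [SFinite μ]
    [SFinite P] {R : Ω → α → ℝ≥0∞} (hR : Measurable (Function.uncurry R)) {σ : α → ℝ≥0∞}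
    (hσ : Measurable σ) (hσ' : ∀ a, σ a ≠ ∞) (h0 : ∀ a, σ a = 0 → ∀ ω, R ω a = 0) {p : ℝ}
    (hp : 1 ≤ p) {K : ℝ≥0∞} (hK : K ≠ ∞) (h : ∀ a, ∫⁻ ω, R ω a ^ p ∂P ≤ K * σ a ^ p) :
    ∫⁻ ω, (∫⁻ a, R ω a ∂μ) ^ p ∂P ≤ K * (∫⁻ a, σ a ∂μ) ^ p := by
  have hp0 : 0 < p := by linarith
  have hR1 : ∀ ω, Measurable (R ω) := fun ω => hR.comp measurable_prodMk_left
  have hR2 : ∀ a, Measurable fun ω => R ω a := fun a => hR.comp measurable_prodMk_right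
  set I := ∫⁻ a, σ a ∂μ with hI
  have hω : ∀ ω, (∫⁻ a, R ω a ∂μ) ^ p ≤ (∫⁻ a, R ω a ^ p * σ a ^ (1 - p) ∂μ) * I ^ (p - 1) := by
    intro ω
    -- Hölder with exponents `p` and `p/(p - 1)` is applied to this factorisation. The expected size
    -- `σ` serves as weight, so that averaging over `ω` turns `R^p σ^{1-p}` into a multiple of `σ`.
    -- Hypothesis `h0` covers the points where `σ` vanishes.
    have e : ∀ a, R ω a = (R ω a ^ p * σ a ^ (1 - p)) ^ (1 / p) * σ a ^ (1 - 1 / p) := by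
      intro a
      by_cases ha : σ a = 0
      · rw [h0 a ha ω, ENNReal.zero_rpow_of_pos hp0, zero_mul,
          ENNReal.zero_rpow_of_pos (by positivity), zero_mul]
      · rw [ENNReal.mul_rpow_of_nonneg _ _ (by positivity), ← ENNReal.rpow_mul,
          ← ENNReal.rpow_mul, mul_assoc, ← ENNReal.rpow_add _ _ ha (hσ' a)]
        have e1 : p * (1 / p) = 1 := by field_simp
        have e2 : (1 - p) * (1 / p) + (1 - 1 / p) = 0 := by field_simp; ring
        rw [e1, e2, ENNReal.rpow_one, ENNReal.rpow_zero, mul_one]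
    have h2 := ENNReal.lintegral_mul_norm_pow_le (μ := μ)
      (f := fun a => R ω a ^ p * σ a ^ (1 - p)) (g := σ) (p := 1 / p) (q := 1 - 1 / p)
      (((hR1 ω).pow_const _).mul (hσ.pow_const _)).aemeasurable hσ.aemeasurable (by positivity)
      (by rw [sub_nonneg, div_le_one hp0]; exact hp) (by ring)
    simp_rw [← e] at h2
    refine (ENNReal.rpow_le_rpow h2 hp0.le).trans (le_of_eq ?_)
    rw [ENNReal.mul_rpow_of_nonneg _ _ hp0.le, ← ENNReal.rpow_mul, ← ENNReal.rpow_mul,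
      show 1 / p * p = 1 by field_simp, show (1 - 1 / p) * p = p - 1 by field_simp,
      ENNReal.rpow_one]
  have hm : Measurable (Function.uncurry fun ω a => R ω a ^ p * σ a ^ (1 - p)) :=
    (hR.pow_const p).mul ((hσ.comp measurable_snd).pow_const _)
  calc ∫⁻ ω, (∫⁻ a, R ω a ∂μ) ^ p ∂P
      ≤ ∫⁻ ω, (∫⁻ a, R ω a ^ p * σ a ^ (1 - p) ∂μ) * I ^ (p - 1) ∂P := lintegral_mono hω
    _ = (∫⁻ a, ∫⁻ ω, R ω a ^ p * σ a ^ (1 - p) ∂P ∂μ) * I ^ (p - 1) := by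
        have hm1 : Measurable fun ω => ∫⁻ a, R ω a ^ p * σ a ^ (1 - p) ∂μ :=
          hm.lintegral_prod_right'
        rw [lintegral_mul_const _ hm1, lintegral_lintegral_swap hm.aemeasurable]
    _ ≤ (∫⁻ a, K * σ a ∂μ) * I ^ (p - 1) := by
        gcongr with a
        rw [lintegral_mul_const _ ((hR2 a).pow_const p)]
        by_cases ha : σ a = 0
        · simp [h0 a ha, hp0]
        · refine (mul_le_mul_left (h a) _).trans (le_of_eq ?_)
          rw [mul_assoc, ← ENNReal.rpow_add _ _ ha (hσ' a), add_sub_cancel, ENNReal.rpow_one]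
    _ = K * (I * I ^ (p - 1)) := by rw [lintegral_const_mul' _ _ hK, mul_assoc]
    _ = _ := by
        congr 1
        nth_rw 1 [← ENNReal.rpow_one I]
        rw [← ENNReal.rpow_add_of_nonneg _ _ zero_le_one (by linarith), add_sub_cancel]

end Moments

/-! ### Semicontinuity of weighted norms -/

/-- After passing to a subsequence that realises the lower limit, and to a further one along which
the transforms converge almost everywhere, this is Fatou's lemma. -/
theorem weightedSq_le_liminf {W : E d → ℝ≥0∞} (hW : Measurable W) (hW' : ∀ ξ, W ξ ≠ ∞)
    {u : ℕ → L2 d} {v : L2 d} (h : Tendsto u atTop (𝓝 v)) :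
    weightedSq W v ≤ liminf (fun k => weightedSq W (u k)) atTop := by
  obtain ⟨ms, hlim, hms⟩ := exists_seq_tendsto_liminf (f := atTop)
    (u := fun k => weightedSq W (u k))
  have hF : Tendsto (fun k => (𝓕 (u (ms k)) : L2 d)) atTop (𝓝 (𝓕 v)) :=
    ((Lp.fourierTransformₗᵢ (E d) ℂ).continuous.tendsto v).comp (h.comp hms)
  obtain ⟨ns, hns, hae⟩ := (tendstoInMeasure_of_tendsto_Lp hF).exists_seq_tendsto_ae
  have hae' := ae_comp_smul (a := (2 * Real.pi)⁻¹) (by positivity) hae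
  calc weightedSq W v = ∫⁻ ξ, liminf (fun k => W ξ * ‖hat (u (ms (ns k))) ξ‖ₑ ^ 2) atTop := by
        refine lintegral_congr_ae ?_
        filter_upwards [hae'] with ξ hξ
        have h1 : Tendsto (fun k => ‖hat (u (ms (ns k))) ξ‖ₑ ^ 2) atTop (𝓝 (‖hat v ξ‖ₑ ^ 2)) :=
          ((ENNReal.continuous_pow 2).tendsto _).comp ((continuous_enorm.tendsto _).comp hξ)
        exact (ENNReal.Tendsto.const_mul h1 (.inr (hW' ξ))).liminf_eq.symm
    _ ≤ liminf (fun k => weightedSq W (u (ms (ns k)))) atTop :=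
        lintegral_liminf_le fun k => hW.mul ((stronglyMeasurable_hat _).measurable.enorm.pow_const 2)
    _ = _ := (hlim.comp hns.tendsto_atTop).liminf_eq

/-! ### Random series -/

section RandomSeries

variable {Ω ι : Type*} [MeasurableSpace Ω] {P : Measure Ω} {c : ℝ} {X : ι → Ω → ℝ}

theorem weightedSq_sum_smul (W : E d → ℝ≥0∞) (t : Finset ι) (x : ι → ℝ) (a : ι → L2 d) :
    weightedSq W (∑ n ∈ t, x n • a n) = ∫⁻ ξ, W ξ * ‖∑ n ∈ t, x n • hat (a n) ξ‖ₑ ^ 2 :=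
  weightedSq_congr (hat_sum_smul t x a)

theorem IsRandomFamily.measurable_weighted_sum (hX : IsRandomFamily P c X) {W : E d → ℝ≥0∞}
    (hW : Measurable W) (t : Finset ι) (a : ι → L2 d) :
    Measurable (Function.uncurry fun ω ξ => W ξ * ‖∑ n ∈ t, X n ω • hat (a n) ξ‖ₑ ^ 2) := by
  refine (hW.comp measurable_snd).mul (Measurable.pow_const (Measurable.enorm ?_) 2)
  exact Finset.measurable_fun_sum t fun n _ => ((hX.measurable n).comp measurable_fst).smul
    ((stronglyMeasurable_hat (a n)).measurable.comp measurable_snd)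

theorem IsRandomFamily.measurable_weightedSq_sum (hX : IsRandomFamily P c X) {W : E d → ℝ≥0∞}
    (hW : Measurable W) (t : Finset ι) (a : ι → L2 d) :
    Measurable fun ω => weightedSq W (∑ n ∈ t, X n ω • a n) := by
  simp_rw [weightedSq_sum_smul]
  exact (hX.measurable_weighted_sum hW t a).lintegral_prod_right'

/-- Khintchine at each frequency, then Minkowski with exponent `p = q/2 ≥ 1`. The comparison
function `σ` is the weighted square function of the pieces. -/
theorem IsRandomFamily.lintegral_weightedSq_sum_rpow_le [SFinite P] (hX : IsRandomFamily P c X)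
    (hc : 0 ≤ c) {W : E d → ℝ≥0∞} (hW : Measurable W) (hW' : ∀ ξ, W ξ ≠ ∞) (t : Finset ι)
    (a : ι → L2 d) {q : ℝ} (hq : 2 ≤ q) :
    ∫⁻ ω, weightedSq W (∑ n ∈ t, X n ω • a n) ^ (q / 2) ∂P ≤
      ENNReal.ofReal (4 * Real.exp c * √q) ^ q * (∑ n ∈ t, weightedSq W (a n)) ^ (q / 2) := by
  have hq0 : 0 < q := by linarith
  have hm : ∀ n, Measurable fun ξ => ‖hat (a n) ξ‖ₑ ^ 2 := fun n =>
    (stronglyMeasurable_hat (a n)).measurable.enorm.pow_const 2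
  have e : ∑ n ∈ t, weightedSq W (a n) = ∫⁻ ξ, W ξ * ∑ n ∈ t, ‖hat (a n) ξ‖ₑ ^ 2 := by
    simp_rw [Finset.mul_sum]
    rw [lintegral_finsetSum (f := fun n ξ => W ξ * ‖hat (a n) ξ‖ₑ ^ 2) _ fun n _ => hW.mul (hm n)]
    rfl
  simp_rw [weightedSq_sum_smul]
  rw [e]
  refine lintegral_lintegral_rpow_le (hX.measurable_weighted_sum hW t a)
    (σ := fun ξ => W ξ * ∑ n ∈ t, ‖hat (a n) ξ‖ₑ ^ 2) (hW.mul (Finset.measurable_fun_sum t fun n _ => hm n)) (fun ξ => ?_) (fun ξ h ω => ?_)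
    (by linarith) (by finiteness) fun ξ => ?_
  · exact ENNReal.mul_ne_top (hW' ξ) (ENNReal.sum_ne_top.2 fun n _ => by finiteness)
  · rcases mul_eq_zero.1 h with h | h
    · rw [h, zero_mul]
    · have hz : ∀ n ∈ t, hat (a n) ξ = 0 := fun n hn => by
        simpa using (Finset.sum_eq_zero_iff.1 h) n hn
      rw [Finset.sum_eq_zero fun n hn => by rw [hz n hn, smul_zero]]
      simp
  · have e2 : ∀ ω, (W ξ * ‖∑ n ∈ t, X n ω • hat (a n) ξ‖ₑ ^ 2) ^ (q / 2) =
        W ξ ^ (q / 2) * ‖∑ n ∈ t, X n ω • hat (a n) ξ‖ₑ ^ q := fun ω => by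
      rw [ENNReal.mul_rpow_of_nonneg _ _ (by positivity), ← ENNReal.rpow_natCast,
        ← ENNReal.rpow_mul]
      congr 2
      push_cast; ring
    simp_rw [e2]
    rw [lintegral_const_mul' _ _ (ENNReal.rpow_ne_top_of_nonneg (by positivity) (hW' ξ)),
      ENNReal.mul_rpow_of_nonneg _ _ (by positivity), ← mul_assoc, mul_comm _ (W ξ ^ _), mul_assoc]
    gcongr
    exact hX.lintegral_enorm_sum_rpow_le hc t _ (by linarith)

theorem IsRandomFamily.memLp_smul (hX : IsRandomFamily P c X) (hc : 0 ≤ c) (n : ι) (z : L2 d) :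
    MemLp (fun ω => X n ω • z) 2 P := by
  have h : MemLp (X n) 2 P := by
    refine ⟨(hX.measurable n).aestronglyMeasurable, ?_⟩
    rw [eLpNorm_lt_top_iff_lintegral_rpow_enorm_lt_top (by norm_num) (by norm_num)]
    have := hX.lintegral_enorm_real_sum_rpow_le hc {n} (fun _ => 1) (σ := 1) (q := 2) one_pos
      (by simp) (by norm_num)
    simp only [Finset.sum_singleton, one_mul] at this
    exact this.trans_lt (by finiteness)
  exact MemLp.of_le_mul (c := ‖z‖) h
    ((hX.measurable n).aestronglyMeasurable.smul_const z)
    (.of_forall fun ω => by rw [norm_smul, mul_comm])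

/-- The case `W = 1`, `q = 2`; Plancherel's constant `κ` appears on both sides and cancels. -/
theorem IsRandomFamily.eLpNorm_sum_sq_le [SFinite P] (hX : IsRandomFamily P c X) (hc : 0 ≤ c)
    (t : Finset ι) (a : ι → L2 d) :
    eLpNorm (fun ω => ∑ n ∈ t, X n ω • a n) 2 P ^ 2 ≤
      ENNReal.ofReal (4 * Real.exp c * √2) ^ 2 * ∑ n ∈ t, ‖a n‖ₑ ^ 2 := by
  have h := hX.lintegral_weightedSq_sum_rpow_le hc (W := fun _ => 1) measurable_const
    (by simp) t a le_rfl
  set κ := ENNReal.ofReal |(2 * Real.pi)⁻¹ ^ d|⁻¹ with hκ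
  have hκ0 : κ ≠ 0 := by
    rw [hκ, ENNReal.ofReal_ne_zero_iff]
    positivity
  simp only [weightedSq_one, ← hκ, div_self (two_ne_zero' ℝ), ENNReal.rpow_one, ENNReal.rpow_two,
    ← Finset.mul_sum] at h
  rw [lintegral_const_mul' _ _ (by finiteness), lintegral_enorm_sq, mul_left_comm] at h
  exact (ENNReal.mul_le_mul_iff_right hκ0 (by finiteness)).1 h

/-- The second-moment bound for finite sums turns summability of `‖a n‖²` into the Cauchy criterion
over finite index sets, which is unconditional convergence. -/
theorem IsRandomFamily.exists_isRandomSum [SFinite P] (hX : IsRandomFamily P c X) (hc : 0 ≤ c)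
    {a : ι → L2 d} (ha : Summable fun n => ‖a n‖ ^ 2) : ∃ F, IsRandomSum P X a F := by
  set u : ι → Lp (L2 d) 2 P := fun n => (hX.memLp_smul hc n (a n)).toLp with hu
  have hsum : ∀ t : Finset ι, (∑ n ∈ t, u n : Lp (L2 d) 2 P) =ᵐ[P]
      fun ω => ∑ n ∈ t, X n ω • a n := fun t => by
    refine (Lp.coeFn_finsetSum t u).trans ?_
    have : ∀ᵐ ω ∂P, ∀ n ∈ t, u n ω = X n ω • a n :=
      (ae_ball_iff t.countable_toSet).2 fun n _ => MemLp.coeFn_toLp _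
    filter_upwards [this] with ω hω
    rw [Finset.sum_apply]
    exact Finset.sum_congr rfl hω
  set K := 4 * Real.exp c * √2 with hK
  have hK0 : 0 < K := by positivity
  have hnorm : ∀ t : Finset ι, ‖∑ n ∈ t, u n‖ ^ 2 ≤ K ^ 2 * ∑ n ∈ t, ‖a n‖ ^ 2 := fun t => by
    have h := hX.eLpNorm_sum_sq_le hc t a
    rw [← eLpNorm_congr_ae (hsum t), ← Lp.enorm_def] at h
    have e : ∀ x : ι → L2 d, ∑ n ∈ t, ‖x n‖ₑ ^ 2 = ENNReal.ofReal (∑ n ∈ t, ‖x n‖ ^ 2) := by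
      intro x
      rw [ENNReal.ofReal_sum_of_nonneg fun _ _ => by positivity]
      simp only [ENNReal.ofReal_pow (norm_nonneg _), ofReal_norm]
    rw [e, ← ofReal_norm, ← ENNReal.ofReal_pow (norm_nonneg _), ← ENNReal.ofReal_pow hK0.le,
      ← ENNReal.ofReal_mul (by positivity)] at h
    exact (ENNReal.ofReal_le_ofReal_iff (by positivity)).1 h
  have hs : Summable u := by
    rw [summable_iff_vanishing_norm] at ha ⊢
    intro ε hε
    obtain ⟨s, hs⟩ := ha (ε ^ 2 / K ^ 2) (by positivity)
    refine ⟨s, fun t ht => ?_⟩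
    have h1 := (le_abs_self _).trans_lt (hs t ht)
    refine lt_of_pow_lt_pow_left₀ 2 hε.le ((hnorm t).trans_lt ?_)
    rwa [lt_div_iff₀ (by positivity), mul_comm] at h1
  obtain ⟨U, hU⟩ := hs
  refine ⟨U, Lp.memLp U, ?_⟩
  have h := tendsto_iff_edist_tendsto_0.1 (show Tendsto _ _ _ from hU)
  refine h.congr fun t => ?_
  rw [Lp.edist_def]
  refine eLpNorm_congr_ae ?_
  filter_upwards [hsum t] with ω hω
  rw [Pi.sub_apply, hω]

/-- Moment bounds for weighted norms of a random series. -/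
theorem IsRandomSum.exists_weightedSq_le [SFinite P] [Countable ι] {a : ι → L2 d} {F : Ω → L2 d}
    (hF : IsRandomSum P X a F) (hX : IsRandomFamily P c X) (hc : 0 ≤ c) {W : E d → ℝ≥0∞}
    (hW : Measurable W) (hW' : ∀ ξ, W ξ ≠ ∞) :
    ∃ G : Ω → ℝ≥0∞, Measurable G ∧ (∀ᵐ ω ∂P, weightedSq W (F ω) ≤ G ω) ∧
      ∀ q : ℝ, 2 ≤ q → ∫⁻ ω, G ω ^ (q / 2) ∂P ≤
        ENNReal.ofReal (4 * Real.exp c * √q) ^ q * (∑' n, weightedSq W (a n)) ^ (q / 2) := by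
  have hm : TendstoInMeasure P (fun (t : Finset ι) ω => ∑ n ∈ t, X n ω • a n) atTop F :=
    tendstoInMeasure_of_tendsto_eLpNorm two_ne_zero
      (fun t => Finset.aestronglyMeasurable_fun_sum t fun n _ =>
        (hX.measurable n).aestronglyMeasurable.smul_const _) hF.memLp.1 hF.tendsto
  obtain ⟨ns, -, hae⟩ := hm.exists_seq_tendsto_ae'
  have hmeas := fun k => hX.measurable_weightedSq_sum hW (ns k) a
  -- The lower limit along the almost surely convergent partial sums is a measurable majorant, so
  -- measurability of `ω ↦ weightedSq W (F ω)` is never needed. It does not depend on `q`.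
  refine ⟨fun ω => liminf (fun k => weightedSq W (∑ n ∈ ns k, X n ω • a n)) atTop,
    .liminf hmeas, ?_, fun q hq => ?_⟩
  · filter_upwards [hae] with ω hω
    exact weightedSq_le_liminf hW hW' hω
  · have hq0 : 0 < q / 2 := by linarith
    calc _ = ∫⁻ ω, liminf (fun k => weightedSq W (∑ n ∈ ns k, X n ω • a n) ^ (q / 2)) atTop ∂P :=
          lintegral_congr fun ω => (ENNReal.orderIsoRpow (q / 2) hq0).liminf_apply
      _ ≤ _ := lintegral_liminf_le fun k => (hmeas k).pow_const _
      _ ≤ _ := liminf_le_of_frequently_le' (Frequently.of_forall fun k =>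
          (hX.lintegral_weightedSq_sum_rpow_le hc hW hW' (ns k) a hq).trans
            (by gcongr; exact ENNReal.sum_le_tsum _))

end RandomSeries

/-! ### Comparison of the Sobolev weights -/

theorem homSobolevWeight_le {s : ℝ} (hs : 0 ≤ s) (ξ : E d) :
    homSobolevWeight s ξ ≤ sobolevWeight s ξ := by
  unfold homSobolevWeight sobolevWeight
  gcongr
  rw [Real.enorm_of_nonneg (by positivity), Real.enorm_of_nonneg (by positivity)]
  refine ENNReal.ofReal_le_ofReal ?_
  calc ‖ξ‖ ^ s = (‖ξ‖ ^ 2) ^ (s / 2) := by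
        rw [← Real.rpow_natCast, ← Real.rpow_mul (norm_nonneg _)]
        congr 1; push_cast; ring
    _ ≤ _ := by gcongr; linarith

theorem sobolevWeight_le_one_add {s : ℝ} (hs : 0 ≤ s) (ξ : E d) :
    sobolevWeight s ξ ≤ ‖(2 ^ (s / 2) : ℝ)‖ₑ ^ 2 * (1 + homSobolevWeight s ξ) := by
  have key : ∀ w : ℝ, 0 ≤ w → (1 + ‖ξ‖ ^ 2) ^ (s / 2) ≤ 2 ^ (s / 2) * w →
      sobolevWeight s ξ ≤ ‖(2 ^ (s / 2) : ℝ)‖ₑ ^ 2 * ‖w‖ₑ ^ 2 := fun w hw h => by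
    unfold sobolevWeight
    rw [← mul_pow]
    gcongr
    rw [← enorm_mul, Real.enorm_of_nonneg (by positivity), Real.enorm_of_nonneg (by positivity)]
    exact ENNReal.ofReal_le_ofReal h
  rcases le_total ‖ξ‖ 1 with h | h
  · refine (key 1 zero_le_one ?_).trans ?_
    · rw [mul_one]
      gcongr
      nlinarith [norm_nonneg ξ]
    · gcongr
      simp
  · refine (key (‖ξ‖ ^ s) (by positivity) ?_).trans ?_
    · calc (1 + ‖ξ‖ ^ 2) ^ (s / 2) ≤ (2 * ‖ξ‖ ^ 2) ^ (s / 2) := by gcongr; nlinarith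
        _ = _ := by
          rw [Real.mul_rpow (by positivity) (by positivity), ← Real.rpow_natCast ‖ξ‖,
            ← Real.rpow_mul (norm_nonneg _)]
          congr 2; push_cast; ring
    · gcongr
      exact le_add_self

/-- Low frequencies are controlled by the `L²` norm, which is finite already, and high ones by the
homogeneous norm. -/
theorem memH_of_homSobolevNorm_lt_top {s : ℝ} (hs : 0 ≤ s) {f : L2 d}
    (h : homSobolevNorm s f < ∞) : MemH s f := by
  unfold MemH
  refine (ENNReal.pow_lt_top_iff (n := 2)).1 ?_ |>.resolve_right two_ne_zero
  rw [sobolevNorm_sq]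
  calc weightedSq (sobolevWeight s) f
      ≤ ∫⁻ ξ, ‖(2 ^ (s / 2) : ℝ)‖ₑ ^ 2 * (1 * ‖hat f ξ‖ₑ ^ 2 +
          homSobolevWeight s ξ * ‖hat f ξ‖ₑ ^ 2) := by
        refine lintegral_mono fun ξ => ?_
        rw [← add_mul, ← mul_assoc]
        gcongr
        exact sobolevWeight_le_one_add hs ξ
    _ = ‖(2 ^ (s / 2) : ℝ)‖ₑ ^ 2 * (weightedSq (fun _ => 1) f + homSobolevNorm s f ^ 2) := by
        rw [lintegral_const_mul' _ _ (by finiteness), lintegral_add_left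
          (((stronglyMeasurable_hat f).measurable.enorm.pow_const 2).const_mul _), homSobolevNorm_sq]
        rfl
    _ < ∞ := by
        rw [weightedSq_one]
        finiteness

/-! ### Square functions of the pieces -/

/-- Only the spatial localisation has a constant depending on `φ` and `S`; the frequency steps cost
the absolute factor three. Hence `A` can be fixed before `χ`, `b` and `s`. -/
theorem exists_tsum_weightedSq_piece_le (hd : 0 < d) {φ : E d → ℝ} (hφ : IsUnitBump φ) (S : ℝ) :
    ∃ A : ℝ≥0∞, A ≠ ∞ ∧ ∀ (χ : E d → ℝ), IsDyadicBump χ →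
      ∀ (b : (k : ℕ) → Fin (numHarm d k) → Sph d → ℂ), IsHarmBasis b →
      ∀ s, 0 ≤ s → s ≤ S → ∀ f : L2 d,
        ∑' n, weightedSq (sobolevWeight s) (piece φ χ b f n) ≤
          A * weightedSq (sobolevWeight s) f := by
  obtain ⟨A, hA, h⟩ := tsum_weightedSq_unitCut_le hφ hd S
  refine ⟨3 * A, by finiteness, fun χ hχ b hb s hs hsS f => ?_⟩
  refine (tsum_weightedSq_piece_le hd hφ hχ hb
    (V := fun r => ‖((1 + r ^ 2) ^ (s / 2) : ℝ)‖ₑ ^ 2) (by fun_prop) f).trans ?_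
  rw [mul_assoc]
  gcongr
  exact h s hs hsS f

theorem summable_norm_piece_sq (hd : 0 < d) {φ χ : E d → ℝ} (hφ : IsUnitBump φ)
    (hχ : IsDyadicBump χ) {b : (k : ℕ) → Fin (numHarm d k) → Sph d → ℂ} (hb : IsHarmBasis b)
    (f : L2 d) : Summable fun n => ‖piece φ χ b f n‖ ^ 2 := by
  obtain ⟨A, hA, h⟩ := exists_tsum_weightedSq_piece_le hd hφ 0
  have h0 := h χ hχ b hb 0 le_rfl le_rfl f
  have hW : (sobolevWeight 0 : E d → ℝ≥0∞) = fun _ => 1 := by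
    funext ξ
    simp [sobolevWeight]
  set κ := ENNReal.ofReal |(2 * Real.pi)⁻¹ ^ d|⁻¹ with hκ
  have hκ0 : κ ≠ 0 := by
    rw [hκ, ENNReal.ofReal_ne_zero_iff]
    positivity
  simp only [hW, weightedSq_one, ← hκ, ENNReal.tsum_mul_left] at h0
  have h1 : ∑' n, ‖piece φ χ b f n‖ₑ ^ 2 ≠ ∞ := by
    intro h2
    rw [h2, ENNReal.mul_top hκ0, top_le_iff] at h0
    exact absurd h0 (by finiteness)
  refine (ENNReal.summable_toReal h1).congr fun n => ?_
  rw [ENNReal.toReal_pow, toReal_enorm]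

/-! ### Moments of the homogeneous Sobolev norm -/

theorem IsRandomSum.moment_homSobolevNorm_le {Ω ι : Type*} [MeasurableSpace Ω] {P : Measure Ω}
    [SFinite P] [Countable ι] {c : ℝ} {X : ι → Ω → ℝ} {a : ι → L2 d} {F : Ω → L2 d}
    (hF : IsRandomSum P X a F) (hX : IsRandomFamily P c X) (hc : 0 ≤ c) {s : ℝ} {T : ℝ≥0∞}
    (hT : ∑' n, weightedSq (homSobolevWeight s) (a n) ≤ T ^ 2) :
    (∀ q : ℝ, 2 ≤ q → eLpNorm (fun ω => homSobolevNorm s (F ω)) (ENNReal.ofReal q) P ≤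
      ENNReal.ofReal (4 * Real.exp c * √q) * T) ∧
    (T ≠ ∞ → ∀ᵐ ω ∂P, homSobolevNorm s (F ω) < ∞) := by
  obtain ⟨G, hG, hFG, hGq⟩ := hF.exists_weightedSq_le hX hc (measurable_homSobolevWeight s)
    (fun ξ => by unfold homSobolevWeight; finiteness)
  have hrpow : ∀ (x : ℝ≥0∞) (q : ℝ), (x ^ 2) ^ (q / 2) = x ^ q := fun x q => by
    rw [← ENNReal.rpow_natCast, ← ENNReal.rpow_mul]
    congr 1; push_cast; ring
  have hGT : ∀ q : ℝ, 2 ≤ q → ∫⁻ ω, G ω ^ (q / 2) ∂P ≤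
      (ENNReal.ofReal (4 * Real.exp c * √q) * T) ^ q := fun q hq => by
    refine (hGq q hq).trans ?_
    rw [ENNReal.mul_rpow_of_nonneg _ _ (by linarith), ← hrpow T q]
    gcongr
  refine ⟨fun q hq => ?_, fun hT' => ?_⟩
  · have hq0 : 0 < q := by linarith
    rw [eLpNorm_eq_lintegral_rpow_enorm_toReal (by simpa using hq0) (by finiteness),
      ENNReal.toReal_ofReal hq0.le, one_div, ENNReal.rpow_inv_le_iff hq0]
    refine le_trans (lintegral_mono_ae ?_) (hGT q hq)
    filter_upwards [hFG] with ω hω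
    rw [enorm_eq_self, ← hrpow, homSobolevNorm_sq]
    gcongr
  -- The second moment of the majorant is finite, hence so is the majorant almost surely.
  · have h2 := hGT 2 le_rfl
    simp only [div_self (two_ne_zero' ℝ), ENNReal.rpow_one] at h2
    filter_upwards [hFG, ae_lt_top hG (h2.trans_lt (by finiteness)).ne] with ω h3 h4
    rw [← homSobolevNorm_sq] at h3
    exact (ENNReal.pow_lt_top_iff.1 (h3.trans_lt h4)).resolve_right two_ne_zero

end Rand

end

/-! ### Proof of the proposition -/

open Rand

theorem propositionA1 (d : ℕ) (hd : 2 ≤ d) (φ : E d → ℝ) (hφ : IsUnitBump φ)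
    (c : ℝ) (hc : 0 < c) (S : ℝ) (hS : 0 < S) :
    ∃ C : ℝ, 0 < C ∧
      ∀ (χ : E d → ℝ), IsDyadicBump χ →
      ∀ (b : (k : ℕ) → Fin (numHarm d k) → Sph d → ℂ), IsHarmBasis b →
      ∀ (Ω : Type*) [MeasurableSpace Ω] (P : Measure Ω) [IsProbabilityMeasure P]
        (X : Idx d → Ω → ℝ), IsRandomFamily P c X →
      ∀ (s : ℝ), 0 < s → s ≤ S →
      ∀ (f : L2 d), MemH s f →
        (∃ F : Ω → L2 d, IsRandomisation P φ χ b X f F) ∧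
        ∀ F : Ω → L2 d, IsRandomisation P φ χ b X f F →
          (∀ q : ℝ, 2 ≤ q →
            eLpNorm (fun ω => homSobolevNorm s (F ω)) (ENNReal.ofReal q) P
              ≤ ENNReal.ofReal (C * √q) * sobolevNorm s f) ∧
          ∀ᵐ ω ∂P, MemH s (F ω) := by
  have hd0 : 0 < d := by omega
  obtain ⟨A, hA, hpiece⟩ := exists_tsum_weightedSq_piece_le hd0 hφ S
  set B := A ^ (1 / 2 : ℝ) with hB
  have hBtop : B ≠ ∞ := ENNReal.rpow_ne_top_of_nonneg (by norm_num) hA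
  have hB2 : B ^ 2 = A := by
    rw [hB, ← ENNReal.rpow_natCast, ← ENNReal.rpow_mul]
    norm_num
  -- `B` is the square root of the square-sum constant. The added `1` only keeps `C` positive should
  -- `B` vanish.
  refine ⟨4 * Real.exp c * B.toReal + 1, by positivity, ?_⟩
  intro χ hχ b hb Ω _ P _ X hX s hs hsS f hf
  refine ⟨hX.exists_isRandomSum hc.le (summable_norm_piece_sq hd0 hφ hχ hb f), fun F hF => ?_⟩
  have hT : ∑' n, weightedSq (homSobolevWeight s) (piece φ χ b f n) ≤
      (B * sobolevNorm s f) ^ 2 := by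
    rw [mul_pow, hB2, sobolevNorm_sq]
    -- The homogeneous weight is weakened to the inhomogeneous one on each piece, because the
    -- localisation estimate is for `H^s`.
    refine le_trans (ENNReal.tsum_le_tsum fun n => lintegral_mono fun ξ => ?_)
      (hpiece χ hχ b hb s hs.le hsS f)
    gcongr
    exact homSobolevWeight_le hs.le ξ
  obtain ⟨h1, h2⟩ := IsRandomSum.moment_homSobolevNorm_le hF hX hc.le hT
  refine ⟨fun q hq => (h1 q hq).trans ?_, ?_⟩
  · rw [← mul_assoc]
    refine mul_le_mul_left ?_ _
    calc ENNReal.ofReal (4 * Real.exp c * √q) * B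
        = ENNReal.ofReal (4 * Real.exp c * √q * B.toReal) := by
          rw [ENNReal.ofReal_mul (q := B.toReal) (by positivity), ENNReal.ofReal_toReal hBtop]
      _ ≤ _ := ENNReal.ofReal_le_ofReal (by nlinarith [Real.sqrt_nonneg q])
  · filter_upwards [h2 (ENNReal.mul_ne_top hBtop hf.ne)] with ω hω
    exact memH_of_homSobolevNorm_lt_top hs.le hω
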